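/- **Setting.** Let $L\ge 2$, and let $n_0,n_1,\dots,n_L$ and $N$ be natural numbers with $n_1\ge N$ and $n_2\ge n_3\ge\dots\ge n_L$. Let $X\in\mathbb R^{N\times n_0}$, $Y\in\mathbb R^{N\times n_L}$. For parameters $\theta=(W_l)_{l=1}^L$, $W_l\in\mathbb R^{n_{l-1}\times n_l}$, normed by $\|\theta\|_2=\big(\sum_{l}\|W_l\|_F^2\big)^{1/2}$, set $F_0=X$, $F_l=\sigma(F_{l-1}W_l)$ (entrywise) for $1\le l\le L-1$, $F_L=F_{L-1}W_L$, and $\Phi(\theta)=\frac12\|F_L(\theta)-Y\|_F^2$. Let $\gamma\in(0,1)$, $\beta>0$, and let $\sigma:\mathbb R\to\mathbb R$ be differentiable with $\sigma'(x)\in[\gamma,1]$ and $|\sigma(x)|\le|x|$ for all $x$, and $\sigma'$ $\beta$-Lipschitz. Gradient descent with step size $\eta>0$ from $\theta_0=(W_l^0)_{l=1}^L$ is $\theta_{k+1}=\theta_k-\eta\nabla\Phi(\theta_k)$. For an $m\times n$ matrix $A$, $\|A\|_2$ and $\sigma_{\min}(A)$ denote the largest and the smallest of its $\min(m,n)$ singular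 values. Put $\lambda_l=\sigma_{\min}(W_l^0)$; $\bar\lambda_l=\frac23(1+\|W_l^0\|_2)$ for $l\in\{1,2\}$ and $\bar\lambda_l=\|W_l^0\|_2$ for $l\in\{3,\dots,L\}$; $\lambda_{i\to j}=\prod_{l=i}^j\lambda_l$, $\bar\lambda_{i\to j}=\prod_{l=i}^j\bar\lambda_l$ (empty products are $1$); and $\lambda_F=\sigma_{\min}(\sigma(XW_1^0))$. **Theorem.** Assume that $\lambda_F>0$, that $\lambda_l>0$ for $3\le l\le L$, and that $$\lambda_F^2\ \ge\ \frac{\gamma^4}{3}\Big(\frac{6}{\gamma^2}\Big)^{L}\|X\|_F\sqrt{2\Phi(\theta_0)}\,\frac{\bar\lambda_{3\to L}}{\lambda_{3\to L}^2}\,\max\Big(\frac{2\bar\lambda_1\bar\lambda_2}{\min_{l\in\{3,\dots,L\}}\lambda_l\bar\lambda_l},\ \bar\lambda_1,\ \bar\lambda_2\Big),$$ $$\lambda_F^3\ \ge\ \frac{2\gamma^4}{3}\Big(\frac{6}{\gamma^2}\Big)^{L}\|X\|_2\|X\|_F\sqrt{2\Phi(\theta_0)}\,\frac{\bar\lambda_{3\to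 L}}{\lambda_{3\to L}^2}\,\bar\lambda_2,$$ where for $L=2$ the first entry of the maximum is $0$ (the minimum over the empty set is $+\infty$). Define $$\alpha_0=\frac{4}{\gamma^4}\Big(\frac{\gamma^2}{4}\Big)^L\lambda_F^2\lambda_{3\to L}^2,\qquad R=\prod_{p=1}^L\max\big(1,\tfrac32\bar\lambda_p\big),$$ $$Q_0=L\sqrt L\Big(\frac32\Big)^{2(L-1)}\|X\|_F^2\frac{\bar\lambda_{1\to L}^2}{\min_{1\le l\le L}\bar\lambda_l^2}+L\sqrt L\,\|X\|_F\big(1+L\beta\|X\|_FR\big)R\sqrt{2\Phi(\theta_0)},$$ $$Q_1=\frac43\Big(\frac32\Big)^L\frac{\|X\|_F}{\alpha_0}\sum_{l=1}^L\frac{\bar\lambda_{1\to L}}{\bar\lambda_l}\sqrt{2\Phi(\theta_0)},$$ and let $0<\eta<\min\big(\frac1{\alpha_0},\frac1{Q_0}\big)$. Then $0<1-\eta\alpha_0<1$, and for every $k\ge 0$ $$\Phi(\theta_k)\le(1-\eta\alpha_0)^k\,\Phi(\theta_0).$$ Furthermore, the iterates $\theta_k$ converge to a global minimizer $\theta_*$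 of $\Phi$, and for every $k\ge0$ $$\|\theta_k-\theta_*\|_2\le(1-\eta\alpha_0)^{k/2}\,Q_1 .$$ -/

import Mathlib

open Filter Topology

noncomputable section

namespace PyramidalNet

/-! ### Matrix norms and singular values -/

section Norms

open scoped Matrix.Norms.Frobenius in
/-- Frobenius norm of a real matrix. -/
def frobNorm {m n : ℕ} (A : Matrix (Fin m) (Fin n) ℝ) : ℝ := ‖A‖

open scoped Matrix.Norms.L2Operator in
/-- Spectral norm (largest singular value) of a real matrix: the operator norm for the
Euclidean norms. -/
def opNorm {m n : ℕ} (A : Matrix (Fin m) (Fin n) ℝ) : ℝ := ‖A‖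

/-- Smallest of the `min m n` singular values of an `m × n` matrix. Mathlib lists the singular
values in decreasing order, starting from index `0`, so this is the one of index `min m n - 1`. -/
def svMin {m n : ℕ} (A : Matrix (Fin m) (Fin n) ℝ) : ℝ :=
  (Matrix.toEuclideanLin A).singularValues (min m n - 1)

end Norms

/-! ### The network

`n l` is the width of layer `l` for `0 ≤ l ≤ L` (`n 0` is the input dimension; values beyond `L`
are never used). Weight matrices are indexed by `i : Fin L`; the index `i` stands for layer
`i + 1`. -/

/-- The parameter space: all tuples of weight matrices, with the norm
`‖θ‖² = ∑ l, ‖W_l‖_F²`. -/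
abbrev Params (L : ℕ) (n : ℕ → ℕ) : Type :=
  PiLp 2 (fun i : Fin L => EuclideanSpace ℝ (Fin (n i) × Fin (n (i + 1))))

/-- The weight matrix `W_{i+1}` (of size `n_i × n_{i+1}`) of a parameter `θ`. -/
def weight {L : ℕ} {n : ℕ → ℕ} (θ : Params L n) (i : Fin L) :
    Matrix (Fin (n i)) (Fin (n (i + 1))) ℝ :=
  Matrix.of fun a b => θ i (a, b)

/-- The output `F_l` of layer `l`: `F_0 = X`, `F_l = σ(F_{l-1} W_l)` entrywise for `0 < l < L`, and
`F_L = F_{L-1} W_L`. -/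
def layer {N L : ℕ} {n : ℕ → ℕ} (σ : ℝ → ℝ) (X : Matrix (Fin N) (Fin (n 0)) ℝ)
    (θ : Params L n) : (l : ℕ) → l ≤ L → Matrix (Fin N) (Fin (n l)) ℝ
  | 0, _ => X
  | l + 1, h =>
    if l + 1 = L then layer σ X θ l (Nat.le_of_succ_le h) * weight θ ⟨l, h⟩
    else (layer σ X θ l (Nat.le_of_succ_le h) * weight θ ⟨l, h⟩).map σ

/-- The square loss `Φ(θ) = ½ ‖F_L(θ) - Y‖_F²`. -/
def loss {N L : ℕ} {n : ℕ → ℕ} (σ : ℝ → ℝ) (X : Matrix (Fin N) (Fin (n 0)) ℝ)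
    (Y : Matrix (Fin N) (Fin (n L)) ℝ) (θ : Params L n) : ℝ :=
  1 / 2 * frobNorm (layer σ X θ L le_rfl - Y) ^ 2

/-- Gradient descent on the loss with step size `η`, started at `θ₀`. -/
def gd {N L : ℕ} {n : ℕ → ℕ} (σ : ℝ → ℝ) (X : Matrix (Fin N) (Fin (n 0)) ℝ)
    (Y : Matrix (Fin N) (Fin (n L)) ℝ) (η : ℝ) (θ₀ : Params L n) : ℕ → Params L n
  | 0 => θ₀
  | k + 1 => gd σ X Y η θ₀ k - η • gradient (loss σ X Y) (gd σ X Y η θ₀ k)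

/-- The activation: `σ' ∈ [γ, 1]`, `|σ(x)| ≤ |x|`, and `σ'` is `β`-Lipschitz. -/
structure IsActivation (γ β : ℝ) (σ : ℝ → ℝ) : Prop where
  differentiable : Differentiable ℝ σ
  deriv_mem : ∀ x, deriv σ x ∈ Set.Icc γ 1
  abs_le : ∀ x, |σ x| ≤ |x|
  deriv_lipschitz : ∀ x y, |deriv σ x - deriv σ y| ≤ β * |x - y|

/-- Pyramidal topology: `n₁ ≥ N` and `n₂ ≥ n₃ ≥ … ≥ n_L`. -/
def IsPyramidal (N L : ℕ) (n : ℕ → ℕ) : Prop :=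
  N ≤ n 1 ∧ ∀ l, 2 ≤ l → l + 1 ≤ L → n (l + 1) ≤ n l

/-! ### Quantities at initialization -/

/-- `λ_{i+1}`, the smallest singular value of `W_{i+1}`. -/
def lam {L : ℕ} {n : ℕ → ℕ} (θ : Params L n) (i : Fin L) : ℝ := svMin (weight θ i)

/-- `λ̄_{i+1}`: equal to `(2/3)(1 + ‖W_{i+1}‖₂)` for the first two layers and to `‖W_{i+1}‖₂` for
the others. -/
def lamBar {L : ℕ} {n : ℕ → ℕ} (θ : Params L n) (i : Fin L) : ℝ :=
  if (i : ℕ) < 2 then 2 / 3 * (1 + opNorm (weight θ i)) else opNorm (weight θ i)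

/-- `λ_{3 → L}`, the product of `λ_l` over the layers `3 ≤ l ≤ L` (index `i ≥ 2`). -/
def lamTop {L : ℕ} {n : ℕ → ℕ} (θ : Params L n) : ℝ :=
  ∏ i ∈ Finset.univ.filter (fun i : Fin L => 2 ≤ (i : ℕ)), lam θ i

/-- `λ̄_{3 → L}`, the product of `λ̄_l` over the layers `3 ≤ l ≤ L`. -/
def lamBarTop {L : ℕ} {n : ℕ → ℕ} (θ : Params L n) : ℝ :=
  ∏ i ∈ Finset.univ.filter (fun i : Fin L => 2 ≤ (i : ℕ)), lamBar θ i

/-- `λ̄_{1 → L}`. -/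
def lamBarProd {L : ℕ} {n : ℕ → ℕ} (θ : Params L n) : ℝ := ∏ i : Fin L, lamBar θ i

/-- The minimum of `λ_l λ̄_l` over the layers `3 ≤ l ≤ L`. -/
def minLamTop {L : ℕ} {n : ℕ → ℕ} (θ : Params L n) : ℝ :=
  ⨅ i : {i : Fin L // 2 ≤ (i : ℕ)}, lam θ i * lamBar θ i

/-- `λ_F`, the smallest singular value of `σ(X W₁)`. -/
def lamF {N L : ℕ} {n : ℕ → ℕ} (hL : 2 ≤ L) (σ : ℝ → ℝ) (X : Matrix (Fin N) (Fin (n 0)) ℝ)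
    (θ : Params L n) : ℝ :=
  svMin ((X * weight θ ⟨0, by omega⟩).map σ)

/-- First initial condition. For `L = 2` there is no layer `l ≥ 3`: the minimum over the empty set
is `+∞` and the first entry of the maximum is `0`, which is also the value that the code gives
(`minLamTop` is then `0`, and division by `0` gives `0`). -/
def InitCond₁ {N L : ℕ} {n : ℕ → ℕ} (hL : 2 ≤ L) (γ : ℝ) (σ : ℝ → ℝ)
    (X : Matrix (Fin N) (Fin (n 0)) ℝ) (Y : Matrix (Fin N) (Fin (n L)) ℝ)
    (θ₀ : Params L n) : Prop :=
  γ ^ 4 / 3 * (6 / γ ^ 2) ^ L * frobNorm X * √(2 * loss σ X Y θ₀)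
      * (lamBarTop θ₀ / lamTop θ₀ ^ 2)
      * max (2 * lamBar θ₀ ⟨0, by omega⟩ * lamBar θ₀ ⟨1, by omega⟩ / minLamTop θ₀)
          (max (lamBar θ₀ ⟨0, by omega⟩) (lamBar θ₀ ⟨1, by omega⟩))
    ≤ lamF hL σ X θ₀ ^ 2

/-- Second initial condition. -/
def InitCond₂ {N L : ℕ} {n : ℕ → ℕ} (hL : 2 ≤ L) (γ : ℝ) (σ : ℝ → ℝ)
    (X : Matrix (Fin N) (Fin (n 0)) ℝ) (Y : Matrix (Fin N) (Fin (n L)) ℝ)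
    (θ₀ : Params L n) : Prop :=
  2 * γ ^ 4 / 3 * (6 / γ ^ 2) ^ L * opNorm X * frobNorm X * √(2 * loss σ X Y θ₀)
      * (lamBarTop θ₀ / lamTop θ₀ ^ 2) * lamBar θ₀ ⟨1, by omega⟩
    ≤ lamF hL σ X θ₀ ^ 3

/-! ### The constants of the rate -/

/-- `α₀ = (4/γ⁴) (γ²/4)^L λ_F² λ_{3 → L}²`. -/
def α₀ {N L : ℕ} {n : ℕ → ℕ} (hL : 2 ≤ L) (γ : ℝ) (σ : ℝ → ℝ)
    (X : Matrix (Fin N) (Fin (n 0)) ℝ) (θ₀ : Params L n) : ℝ :=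
  4 / γ ^ 4 * (γ ^ 2 / 4) ^ L * lamF hL σ X θ₀ ^ 2 * lamTop θ₀ ^ 2

/-- `R = ∏_{p=1}^L max(1, (3/2) λ̄_p)`. -/
def R {L : ℕ} {n : ℕ → ℕ} (θ₀ : Params L n) : ℝ :=
  ∏ i : Fin L, max 1 (3 / 2 * lamBar θ₀ i)

/-- `Q₀ = L√L (3/2)^{2(L-1)} ‖X‖_F² λ̄_{1→L}² / min_l λ̄_l²
  + L√L ‖X‖_F (1 + Lβ‖X‖_F R) R √(2Φ(θ₀))`. -/
def Q₀ {N L : ℕ} {n : ℕ → ℕ} (β : ℝ) (σ : ℝ → ℝ) (X : Matrix (Fin N) (Fin (n 0)) ℝ)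
    (Y : Matrix (Fin N) (Fin (n L)) ℝ) (θ₀ : Params L n) : ℝ :=
  L * √L * (3 / 2) ^ (2 * (L - 1)) * frobNorm X ^ 2
      * (lamBarProd θ₀ ^ 2 / ⨅ i : Fin L, lamBar θ₀ i ^ 2)
    + L * √L * frobNorm X * (1 + L * β * frobNorm X * R θ₀) * R θ₀ * √(2 * loss σ X Y θ₀)

/-- `Q₁ = (4/3) (3/2)^L (‖X‖_F / α₀) ∑_l (λ̄_{1→L} / λ̄_l) √(2Φ(θ₀))`. -/
def Q₁ {N L : ℕ} {n : ℕ → ℕ} (hL : 2 ≤ L) (γ : ℝ) (σ : ℝ → ℝ)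
    (X : Matrix (Fin N) (Fin (n 0)) ℝ) (Y : Matrix (Fin N) (Fin (n L)) ℝ)
    (θ₀ : Params L n) : ℝ :=
  4 / 3 * (3 / 2) ^ L * (frobNorm X / α₀ hL γ σ X θ₀)
    * (∑ i : Fin L, lamBarProd θ₀ / lamBar θ₀ i) * √(2 * loss σ X Y θ₀)

end PyramidalNet

end

namespace PyramidalNet

/-! ### Frobenius norm, spectral norm and singular values -/

section MatrixBounds

open scoped Matrix.Norms.Frobenius

open Matrix WithLp

variable {k m n : ℕ}

/-! Although the loss is not convex, on a suitable neighbourhood of the initialization it satisfies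
a Polyak–Łojasiewicz inequality and a quadratic upper bound. These two facts give geometric decay,
and the decay in turn keeps the iterates inside the neighbourhood.

The inequality `‖∇Φ‖² ≥ 2 α₀ Φ` comes from the gradient in the second weight matrix alone.
Backpropagating the residual multiplies it by `W_lᵀ` for `l ≥ 3`, by activation derivatives, and
finally by `F₁ᵀ`. Each operation is bounded below: the upper weights do not widen, `F₁` has at least
as many columns as rows, and `σ' ≥ γ` (`exists_backprop`, `le_norm_gradient`,
`Near.le_norm_gradient_sq`). The neighbourhood `Near` is small enough that the relevant singular
values keep at least half their initial size, which explains the powers of 4 in `α₀`.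

The upper bound `loss_add_le` with constant `Q₀` comes from a layer-by-layer Taylor remainder, which
needs norm bounds only at the two endpoints of a step. Together with the previous inequality, one
step from `Near` into `Near` multiplies the loss by at most `1 - η α₀` (`loss_gradient_step_le`).

The argument closes in `gd_invariant`. The gradient of each layer is at most a constant times
`√(2Φ)`, so with `u = √(1 - η α₀)` the steps decay like `u ^ k`. Their total length involves `η / (1
- u) = (1 + u) / α₀ ≤ 2 / α₀`, which is how `radius` is chosen; the initial conditions say that
these radii are small enough. Geometric steps make the iterates Cauchy. The loss at the limit is
zero, so the limit is a global minimizer, and the tail of the geometric series is controlled by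
`Q₁`, the sum of the radii. -/

/-- The Frobenius inner product. -/
noncomputable def frobInner (A B : Matrix (Fin m) (Fin n) ℝ) : ℝ := ∑ i, ∑ j, A i j * B i j

theorem norm_sq_eq_sum (A : Matrix (Fin m) (Fin n) ℝ) : ‖A‖ ^ 2 = ∑ i, ∑ j, A i j ^ 2 := by
  rw [Matrix.frobenius_norm_def, ← Real.sqrt_eq_rpow, Real.sq_sqrt (by positivity)]
  simp

theorem norm_sq_eq_sum_row (A : Matrix (Fin m) (Fin n) ℝ) :
    ‖A‖ ^ 2 = ∑ i, ‖toLp 2 (A i)‖ ^ 2 := by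
  rw [norm_sq_eq_sum]
  simp [EuclideanSpace.norm_sq_eq]

theorem norm_eq_norm_toLp (A : Matrix (Fin m) (Fin n) ℝ) :
    ‖A‖ = ‖toLp 2 (fun p : Fin m × Fin n => A p.1 p.2)‖ := by
  rw [← sq_eq_sq₀ (norm_nonneg _) (norm_nonneg _), norm_sq_eq_sum, EuclideanSpace.norm_sq_eq,
    Fintype.sum_prod_type]
  simp

theorem norm_le_mul_of_abs_le {A B : Matrix (Fin m) (Fin n) ℝ} {c : ℝ} (hc : 0 ≤ c)
    (h : ∀ i j, |A i j| ≤ c * |B i j|) : ‖A‖ ≤ c * ‖B‖ := by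
  refine le_of_sq_le_sq ?_ (by positivity)
  rw [mul_pow, norm_sq_eq_sum, norm_sq_eq_sum, Finset.mul_sum]
  refine Finset.sum_le_sum fun i _ => ?_
  rw [Finset.mul_sum]
  refine Finset.sum_le_sum fun j _ => ?_
  rw [← sq_abs (A i j), ← sq_abs (B i j), ← mul_pow]
  exact pow_le_pow_left₀ (abs_nonneg _) (h i j) 2

theorem norm_le_of_abs_le {A B : Matrix (Fin m) (Fin n) ℝ}
    (h : ∀ i j, |A i j| ≤ |B i j|) : ‖A‖ ≤ ‖B‖ := by
  simpa using norm_le_mul_of_abs_le zero_le_one (by simpa using h)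

theorem mul_norm_le_of_le_abs {A B : Matrix (Fin m) (Fin n) ℝ} {c : ℝ} (hc : 0 < c)
    (h : ∀ i j, c * |A i j| ≤ |B i j|) : c * ‖A‖ ≤ ‖B‖ := by
  have := norm_le_mul_of_abs_le (A := A) (B := B) (c := c⁻¹) (by positivity) fun i j => by
    rw [inv_mul_eq_div, le_div_iff₀' hc]; exact h i j
  rwa [inv_mul_eq_div, le_div_iff₀' hc] at this

theorem abs_apply_le_norm (A : Matrix (Fin m) (Fin n) ℝ) (i : Fin m) (j : Fin n) :
    |A i j| ≤ ‖A‖ := by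
  refine abs_le_of_sq_le_sq ?_ (norm_nonneg _)
  rw [norm_sq_eq_sum]
  exact (Finset.single_le_sum (f := fun j => A i j ^ 2) (fun _ _ => sq_nonneg _)
    (Finset.mem_univ j)).trans (Finset.single_le_sum (f := fun i => ∑ j, A i j ^ 2)
    (fun _ _ => Finset.sum_nonneg fun _ _ => sq_nonneg _) (Finset.mem_univ i))

/-- One of the two factors `|B i j|` is absorbed into the Frobenius norm. This turns the entrywise
Taylor error of the activation into a matrix bound free of dimensions. -/
theorem norm_le_mul_sq_of_abs_le {A B : Matrix (Fin m) (Fin n) ℝ} {c : ℝ} (hc : 0 ≤ c)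
    (h : ∀ i j, |A i j| ≤ c * B i j ^ 2) : ‖A‖ ≤ c * ‖B‖ ^ 2 := by
  have := norm_le_mul_of_abs_le (A := A) (B := B) (c := c * ‖B‖) (by positivity) fun i j => by
    refine (h i j).trans ?_
    rw [mul_assoc, ← sq_abs, sq]
    gcongr
    exact abs_apply_le_norm B i j
  rwa [mul_assoc, ← sq] at this

theorem frobInner_eq_inner (A B : Matrix (Fin m) (Fin n) ℝ) :
    frobInner A B = inner ℝ (toLp 2 (fun p : Fin m × Fin n => A p.1 p.2))
      (toLp 2 (fun p : Fin m × Fin n => B p.1 p.2)) := by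
  simp [frobInner, PiLp.inner_apply, Fintype.sum_prod_type, mul_comm]

theorem abs_frobInner_le (A B : Matrix (Fin m) (Fin n) ℝ) : |frobInner A B| ≤ ‖A‖ * ‖B‖ := by
  rw [frobInner_eq_inner, norm_eq_norm_toLp, norm_eq_norm_toLp]
  exact abs_real_inner_le_norm _ _

theorem frobInner_self (A : Matrix (Fin m) (Fin n) ℝ) : frobInner A A = ‖A‖ ^ 2 := by
  rw [norm_sq_eq_sum]; simp [frobInner, sq]

theorem frobInner_add_left (A B C : Matrix (Fin m) (Fin n) ℝ) :
    frobInner (A + B) C = frobInner A C + frobInner B C := by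
  simp [frobInner, add_mul, Finset.sum_add_distrib]

theorem frobInner_smul_left (c : ℝ) (A B : Matrix (Fin m) (Fin n) ℝ) :
    frobInner (c • A) B = c * frobInner A B := by
  simp [frobInner, Finset.mul_sum, mul_assoc]

theorem norm_add_sq_frobInner (A B : Matrix (Fin m) (Fin n) ℝ) :
    ‖A + B‖ ^ 2 = ‖A‖ ^ 2 + 2 * frobInner A B + ‖B‖ ^ 2 := by
  simp only [norm_sq_eq_sum, frobInner, Finset.mul_sum, ← Finset.sum_add_distrib]
  refine Finset.sum_congr rfl fun i _ => Finset.sum_congr rfl fun j _ => ?_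
  simp only [Matrix.add_apply]; ring

theorem frobInner_eq_trace (A B : Matrix (Fin m) (Fin n) ℝ) :
    frobInner A B = (Aᵀ * B).trace := by
  simp only [frobInner, Matrix.trace, Matrix.diag, Matrix.mul_apply, Matrix.transpose_apply]
  exact Finset.sum_comm

theorem frobInner_mul_left (A : Matrix (Fin k) (Fin m) ℝ) (V : Matrix (Fin m) (Fin n) ℝ)
    (B : Matrix (Fin k) (Fin n) ℝ) : frobInner (A * V) B = frobInner V (Aᵀ * B) := by
  simp [frobInner_eq_trace, Matrix.transpose_mul, Matrix.mul_assoc]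

theorem frobInner_mul_right (V : Matrix (Fin k) (Fin m) ℝ) (W : Matrix (Fin m) (Fin n) ℝ)
    (B : Matrix (Fin k) (Fin n) ℝ) : frobInner (V * W) B = frobInner V (B * Wᵀ) := by
  rw [frobInner_eq_trace, frobInner_eq_trace, Matrix.transpose_mul, Matrix.mul_assoc,
    Matrix.trace_mul_comm, Matrix.mul_assoc]

theorem norm_toEuclideanLin_le (A : Matrix (Fin m) (Fin n) ℝ) (x : EuclideanSpace ℝ (Fin n)) :
    ‖toEuclideanLin A x‖ ≤ opNorm A * ‖x‖ :=
  (toEuclideanLin.trans LinearMap.toContinuousLinearMap A).le_opNorm x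

theorem opNorm_nonneg (A : Matrix (Fin m) (Fin n) ℝ) : 0 ≤ opNorm A :=
  norm_nonneg (toEuclideanLin.trans LinearMap.toContinuousLinearMap A)

theorem opNorm_le_bound {A : Matrix (Fin m) (Fin n) ℝ} {c : ℝ} (hc : 0 ≤ c)
    (h : ∀ x, ‖toEuclideanLin A x‖ ≤ c * ‖x‖) : opNorm A ≤ c :=
  ContinuousLinearMap.opNorm_le_bound _ hc h

theorem opNorm_transpose (A : Matrix (Fin m) (Fin n) ℝ) : opNorm Aᵀ = opNorm A := by
  rw [← Matrix.conjTranspose_eq_transpose_of_trivial]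
  exact Matrix.l2_opNorm_conjTranspose A

theorem opNorm_add_le (A B : Matrix (Fin m) (Fin n) ℝ) : opNorm (A + B) ≤ opNorm A + opNorm B := by
  refine opNorm_le_bound (add_nonneg (opNorm_nonneg _) (opNorm_nonneg _)) fun x => ?_
  rw [map_add, LinearMap.add_apply, add_mul]
  exact (norm_add_le _ _).trans
    (add_le_add (norm_toEuclideanLin_le _ _) (norm_toEuclideanLin_le _ _))

/-- Right multiplication by `Wᵀ` applies `W` to each row, so upper and lower bounds for `W` on
vectors transfer to Frobenius norms. -/
theorem norm_mul_transpose_sq (M : Matrix (Fin k) (Fin n) ℝ) (W : Matrix (Fin m) (Fin n) ℝ) :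
    ‖M * Wᵀ‖ ^ 2 = ∑ i, ‖toEuclideanLin W (toLp 2 (M i))‖ ^ 2 := by
  rw [norm_sq_eq_sum_row]
  refine Finset.sum_congr rfl fun i _ => ?_
  congr 2
  ext j
  simp [Matrix.mul_apply, Matrix.toLpLin_apply, Matrix.mulVec, dotProduct, mul_comm]

theorem norm_mul_le_norm_mul_opNorm (M : Matrix (Fin k) (Fin m) ℝ) (B : Matrix (Fin m) (Fin n) ℝ) :
    ‖M * B‖ ≤ ‖M‖ * opNorm B := by
  refine le_of_sq_le_sq ?_ (mul_nonneg (norm_nonneg _) (opNorm_nonneg _))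
  have := norm_mul_transpose_sq M Bᵀ
  rw [Matrix.transpose_transpose] at this
  rw [this, mul_pow, norm_sq_eq_sum_row, Finset.sum_mul]
  refine Finset.sum_le_sum fun i _ => ?_
  rw [← mul_pow, mul_comm, ← opNorm_transpose]
  exact pow_le_pow_left₀ (norm_nonneg _) (norm_toEuclideanLin_le _ _) 2

theorem norm_mul_le_opNorm_mul_norm (A : Matrix (Fin k) (Fin m) ℝ) (M : Matrix (Fin m) (Fin n) ℝ) :
    ‖A * M‖ ≤ opNorm A * ‖M‖ := by
  rw [← Matrix.frobenius_norm_transpose, Matrix.transpose_mul, mul_comm, ← opNorm_transpose,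
    ← Matrix.frobenius_norm_transpose M]
  exact norm_mul_le_norm_mul_opNorm _ _

theorem norm_toEuclideanLin_le_norm (A : Matrix (Fin m) (Fin n) ℝ)
    (x : EuclideanSpace ℝ (Fin n)) : ‖toEuclideanLin A x‖ ≤ ‖A‖ * ‖x‖ := by
  refine le_of_sq_le_sq ?_ (by positivity)
  rw [EuclideanSpace.norm_sq_eq, mul_pow, norm_sq_eq_sum_row, Finset.sum_mul]
  refine Finset.sum_le_sum fun i _ => ?_
  have h := abs_real_inner_le_norm x (toLp 2 (A i))
  rw [← mul_pow, Real.norm_eq_abs, mul_comm ‖toLp 2 (A i)‖]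
  refine pow_le_pow_left₀ (abs_nonneg _) (le_trans (le_of_eq ?_) h) 2
  simp [Matrix.toLpLin_apply, Matrix.mulVec, dotProduct, PiLp.inner_apply]

theorem opNorm_le_norm (A : Matrix (Fin m) (Fin n) ℝ) : opNorm A ≤ ‖A‖ :=
  opNorm_le_bound (norm_nonneg _) (norm_toEuclideanLin_le_norm A)

/-- `A` expands the Euclidean norm at least by the factor `s`. -/
def ExpandsBy (A : Matrix (Fin m) (Fin n) ℝ) (s : ℝ) : Prop :=
  ∀ x, s * ‖x‖ ≤ ‖toEuclideanLin A x‖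

theorem ExpandsBy.mono {A : Matrix (Fin m) (Fin n) ℝ} {s t : ℝ} (h : ExpandsBy A s) (hts : t ≤ s) :
    ExpandsBy A t := fun x => (by gcongr : t * ‖x‖ ≤ s * ‖x‖).trans (h x)

theorem ExpandsBy.perturb {A B : Matrix (Fin m) (Fin n) ℝ} {s : ℝ} (h : ExpandsBy A s) :
    ExpandsBy B (s - ‖B - A‖) := fun x => by
  have h₁ := h x
  have h₂ := norm_toEuclideanLin_le_norm (B - A) x
  have h₃ := norm_sub_norm_le (toEuclideanLin A x) (toEuclideanLin B x)
  rw [norm_sub_rev, ← LinearMap.sub_apply, ← map_sub] at h₃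
  linarith

theorem ExpandsBy.mul_norm_le {W : Matrix (Fin m) (Fin n) ℝ} {s : ℝ} (hs : 0 ≤ s)
    (h : ExpandsBy W s) (M : Matrix (Fin k) (Fin n) ℝ) : s * ‖M‖ ≤ ‖M * Wᵀ‖ := by
  refine le_of_sq_le_sq ?_ (norm_nonneg _)
  rw [norm_mul_transpose_sq, mul_pow, norm_sq_eq_sum_row, Finset.mul_sum]
  refine Finset.sum_le_sum fun i _ => ?_
  rw [← mul_pow]
  exact pow_le_pow_left₀ (by positivity) (h _) 2

theorem ExpandsBy.le_opNorm {A : Matrix (Fin m) (Fin n) ℝ} {s : ℝ} (h : ExpandsBy A s)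
    (hn : 0 < n) : s ≤ opNorm A := by
  have h₁ := (h (EuclideanSpace.single ⟨0, hn⟩ 1)).trans (norm_toEuclideanLin_le _ _)
  simpa using h₁

/-! ### Smallest singular values as expansion factors -/

section SingularValues

open Module LinearMap

variable {E F : Type*} [NormedAddCommGroup E] [InnerProductSpace ℝ E] [FiniteDimensional ℝ E]
  [NormedAddCommGroup F] [InnerProductSpace ℝ F] [FiniteDimensional ℝ F]

/-- In an eigenbasis of `T* T`, `‖T x‖²` is the sum of the squared coordinates of `x` weighted by
eigenvalues in decreasing order. Coordinates beyond `i` vanish, and the remaining weights are at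
least the `i`-th. -/
theorem singularValues_mul_norm_le (T : E →ₗ[ℝ] F) {d : ℕ} (hd : finrank ℝ E = d) (i : Fin d)
    {x : E}
    (hx : ∀ j, i < j → inner ℝ (T.isSymmetric_adjoint_comp_self.eigenvectorBasis hd j) x = 0) :
    T.singularValues i * ‖x‖ ≤ ‖T x‖ := by
  set hT := T.isSymmetric_adjoint_comp_self
  set b := hT.eigenvectorBasis hd
  refine le_of_sq_le_sq ?_ (norm_nonneg _)
  have h₁ : ‖T x‖ ^ 2 = ∑ j, hT.eigenvalues hd j * (inner ℝ (b j) x) ^ 2 := by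
    rw [← real_inner_self_eq_norm_sq, ← LinearMap.adjoint_inner_right,
      ← LinearMap.comp_apply, ← b.sum_inner_mul_inner]
    refine Finset.sum_congr rfl fun j _ => ?_
    have : inner ℝ (b j) ((adjoint T ∘ₗ T) x) = hT.eigenvalues hd j * inner ℝ (b j) x := by
      have := hT.eigenvectorBasis_apply_self_apply hd x j
      rw [b.repr_apply_apply, b.repr_apply_apply] at this
      simpa using this
    rw [this, real_inner_comm]; ring
  rw [h₁, mul_pow, ← b.sum_sq_norm_inner_right x, Finset.mul_sum, T.sq_singularValues_fin hd]
  refine Finset.sum_le_sum fun j _ => ?_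
  rw [Real.norm_eq_abs, sq_abs]
  by_cases hij : i < j
  · simp [b, hx j hij]
  · gcongr
    exact hT.eigenvalues_antitone hd (not_lt.mp hij)

end SingularValues

theorem expandsBy_svMin (hmn : n ≤ m) (A : Matrix (Fin m) (Fin n) ℝ) : ExpandsBy A (svMin A) := by
  intro x
  rcases n.eq_zero_or_pos with rfl | hn
  · simp [Subsingleton.elim x 0]
  · have h := singularValues_mul_norm_le (toEuclideanLin A) (d := n) (by simp) ⟨n - 1, by omega⟩
      (x := x) fun j hj => absurd hj (by rw [Fin.lt_def]; simp; omega)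
    rwa [svMin, min_eq_right hmn]

/-- On the span of the top `m` right singular vectors `A` expands by `svMin A > 0`, hence is
injective there and, by dimension, onto. Writing `x = A z` with `z` in that span gives `‖x‖² = ⟪Aᵀ
x, z⟫ ≤ ‖Aᵀ x‖ ‖z‖` and `svMin A * ‖z‖ ≤ ‖x‖`. The singular values of `Aᵀ` never enter. -/
theorem expandsBy_transpose_svMin (hmn : m ≤ n) (A : Matrix (Fin m) (Fin n) ℝ)
    (hA : 0 < svMin A) : ExpandsBy Aᵀ (svMin A) := by
  intro x
  rcases m.eq_zero_or_pos with rfl | hm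
  · simp [Subsingleton.elim x 0]
  set T := toEuclideanLin A with hT
  have hd : Module.finrank ℝ (EuclideanSpace ℝ (Fin n)) = n := by simp
  set b := T.isSymmetric_adjoint_comp_self.eigenvectorBasis hd with hb
  let e : Fin m → EuclideanSpace ℝ (Fin n) := fun j => b (Fin.castLE hmn j)
  let ι : (Fin m → ℝ) →ₗ[ℝ] EuclideanSpace ℝ (Fin n) := Fintype.linearCombination ℝ e
  have he : Orthonormal ℝ e := b.orthonormal.comp _ (Fin.castLE_injective hmn)
  have hι : Function.Injective ι :=
    linearIndependent_iff_injective_fintypeLinearCombination.mp he.linearIndependent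
  have key : ∀ c, svMin A * ‖ι c‖ ≤ ‖T (ι c)‖ := fun c => by
    have h := singularValues_mul_norm_le T hd ⟨m - 1, by omega⟩ (x := ι c) fun j hj => by
      simp only [ι, Fintype.linearCombination_apply, e, inner_sum, inner_smul_right]
      refine Finset.sum_eq_zero fun i _ => ?_
      rw [b.inner_eq_ite, if_neg, mul_zero]
      rintro rfl
      rw [Fin.lt_def] at hj
      simp at hj; omega
    rwa [svMin, min_eq_left hmn]
  have hinj : Function.Injective (T ∘ₗ ι) := by
    rw [injective_iff_map_eq_zero]
    intro c hc
    have h := key c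
    rw [← LinearMap.comp_apply, hc, norm_zero] at h
    have : ‖ι c‖ = 0 := le_antisymm (nonpos_of_mul_nonpos_right h hA) (norm_nonneg _)
    exact hι (by rw [norm_eq_zero.mp this, map_zero])
  have hsurj : Function.Surjective (T ∘ₗ ι) :=
    (LinearMap.injective_iff_surjective_of_finrank_eq_finrank (by simp)).mp hinj
  obtain ⟨c, hc⟩ := hsurj x
  have h₁ := key c
  rw [LinearMap.comp_apply] at hc
  rw [hc] at h₁
  have h₂ : ‖x‖ ^ 2 ≤ ‖toEuclideanLin Aᵀ x‖ * ‖ι c‖ := by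
    have : inner ℝ (toEuclideanLin Aᵀ x) (ι c) = ‖x‖ ^ 2 := by
      rw [← Matrix.conjTranspose_eq_transpose_of_trivial,
        Matrix.toEuclideanLin_conjTranspose_eq_adjoint, LinearMap.adjoint_inner_left, ← hT, hc,
        real_inner_self_eq_norm_sq]
    rw [← this]
    exact real_inner_le_norm _ _
  rcases eq_or_ne x 0 with rfl | hx
  · simp
  · have hx' : 0 < ‖x‖ := norm_pos_iff.mpr hx
    have h₃ : svMin A * ‖x‖ ^ 2 ≤ ‖toEuclideanLin Aᵀ x‖ * ‖x‖ := by
      nlinarith [norm_nonneg (toEuclideanLin Aᵀ x), norm_nonneg (ι c)]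
    nlinarith

end MatrixBounds

/-! ### Activations -/

section Activation

variable {γ β : ℝ} {σ : ℝ → ℝ}

theorem IsActivation.abs_sub_le (hγ : 0 ≤ γ) (hσ : IsActivation γ β σ) (x y : ℝ) :
    |σ y - σ x| ≤ |y - x| := by
  have := Convex.norm_image_sub_le_of_norm_deriv_le (f := σ) (C := 1) (s := Set.univ) (x := x)
    (y := y) (fun z _ => hσ.differentiable z)
    (fun z _ => by
      rw [Real.norm_eq_abs, abs_of_nonneg (hγ.trans (hσ.deriv_mem z).1)]
      exact (hσ.deriv_mem z).2) convex_univ trivial trivial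
  simpa using this

/-- Along the segment from `x` to `y` the derivative of the error at time `t` is at most `β d² t`;
comparison with `β d² t² / 2` avoids a second derivative of `σ`, which need not exist. -/
theorem IsActivation.abs_taylor_le (hσ : IsActivation γ β σ) (x y : ℝ) :
    |σ y - σ x - deriv σ x * (y - x)| ≤ β / 2 * (y - x) ^ 2 := by
  set d := y - x with hd
  let f : ℝ → ℝ := fun t => σ (x + t * d) - σ x - deriv σ x * (t * d)
  have hf : ∀ t, HasDerivAt f (deriv σ (x + t * d) * d - deriv σ x * d) t := fun t => by
    have h₁ : HasDerivAt (fun t : ℝ => t * d) d t := by simpa using (hasDerivAt_id t).mul_const d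
    have h₂ : HasDerivAt (fun t => σ (x + t * d)) (deriv σ (x + t * d) * d) t :=
      (hσ.differentiable _).hasDerivAt.comp t (h₁.const_add x)
    exact (h₂.sub_const _).sub (h₁.const_mul _)
  have hB : ∀ t : ℝ, HasDerivAt (fun t : ℝ => β / 2 * d ^ 2 * t ^ 2) (β * d ^ 2 * t) t :=
    fun t => by
      refine ((hasDerivAt_pow 2 t).const_mul (β / 2 * d ^ 2)).congr_deriv ?_
      push_cast; ring
  have := image_norm_le_of_norm_deriv_right_le_deriv_boundary (f := f) (a := 0) (b := 1)
    (fun t _ => (hf t).continuousAt.continuousWithinAt) (fun t _ => (hf t).hasDerivWithinAt)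
    (by simp [f]) hB (fun t ht => by
      rw [← sub_mul, norm_mul, Real.norm_eq_abs, Real.norm_eq_abs]
      have h := hσ.deriv_lipschitz (x + t * d) x
      rw [add_sub_cancel_left, abs_mul, abs_of_nonneg ht.1] at h
      calc _ ≤ β * (t * |d|) * |d| := by gcongr
        _ = β * |d| ^ 2 * t := by ring
        _ = _ := by rw [sq_abs]) (x := 1) (by simp)
  simpa [f, hd] using this

theorem isActivation_id (hγ : γ ≤ 1) (hβ : 0 ≤ β) : IsActivation γ β id where
  differentiable := differentiable_id
  deriv_mem x := by simp [hγ]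
  abs_le x := le_rfl
  deriv_lipschitz x y := by simp; positivity

/-- The activation producing layer `l + 1`: the identity for the output layer. -/
def act (L : ℕ) (σ : ℝ → ℝ) (l : ℕ) : ℝ → ℝ := if l + 1 = L then id else σ

theorem IsActivation.act (hγ : γ ≤ 1) (hβ : 0 ≤ β) (hσ : IsActivation γ β σ) (L l : ℕ) :
    IsActivation γ β (act L σ l) := by
  unfold PyramidalNet.act
  split_ifs
  exacts [isActivation_id hγ hβ, hσ]

end Activation

/-! ### Forward pass and its directional derivative -/

section Forward

open scoped Matrix.Norms.Frobenius

variable {N L : ℕ} {n : ℕ → ℕ} {γ β : ℝ} {σ : ℝ → ℝ} {X : Matrix (Fin N) (Fin (n 0)) ℝ}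
  {θ v : Params L n} {w d M : ℕ → ℝ}

theorem weight_add (θ v : Params L n) (i : Fin L) :
    weight (θ + v) i = weight θ i + weight v i := rfl

theorem weight_sub (θ v : Params L n) (i : Fin L) :
    weight (θ - v) i = weight θ i - weight v i := rfl

theorem weight_smul (c : ℝ) (v : Params L n) (i : Fin L) :
    weight (c • v) i = c • weight v i := rfl

theorem norm_weight (θ : Params L n) (i : Fin L) : ‖weight θ i‖ = ‖θ i‖ :=
  norm_eq_norm_toLp _

theorem layer_succ (θ : Params L n) {l : ℕ} (h : l + 1 ≤ L) :
    layer σ X θ (l + 1) h =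
      (layer σ X θ l (Nat.le_of_succ_le h) * weight θ ⟨l, h⟩).map (act L σ l) := by
  rw [layer, act]
  split_ifs with h'
  · ext; rfl
  · rfl

/-- Derivative of the output of layer `l` at the parameter `θ` in the direction `v`. -/
noncomputable def layerDeriv (σ : ℝ → ℝ) (X : Matrix (Fin N) (Fin (n 0)) ℝ) (θ v : Params L n) :
    (l : ℕ) → l ≤ L → Matrix (Fin N) (Fin (n l)) ℝ
  | 0, _ => 0
  | l + 1, h => Matrix.of fun a b =>
      deriv (act L σ l) ((layer σ X θ l (Nat.le_of_succ_le h) * weight θ ⟨l, h⟩) a b) *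
        (layerDeriv σ X θ v l (Nat.le_of_succ_le h) * weight θ ⟨l, h⟩ +
          layer σ X θ l (Nat.le_of_succ_le h) * weight v ⟨l, h⟩) a b

theorem layerDeriv_add (σ : ℝ → ℝ) (X : Matrix (Fin N) (Fin (n 0)) ℝ) (θ v v' : Params L n)
    (l : ℕ) (h : l ≤ L) :
    layerDeriv σ X θ (v + v') l h = layerDeriv σ X θ v l h + layerDeriv σ X θ v' l h := by
  induction l with
  | zero => simp [layerDeriv]
  | succ l ih =>
    ext a b
    simp only [layerDeriv, ih, weight_add, Matrix.add_mul, Matrix.mul_add, Matrix.of_apply,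
      Matrix.add_apply]
    ring

theorem layerDeriv_smul (σ : ℝ → ℝ) (X : Matrix (Fin N) (Fin (n 0)) ℝ) (θ v : Params L n) (c : ℝ)
    (l : ℕ) (h : l ≤ L) :
    layerDeriv σ X θ (c • v) l h = c • layerDeriv σ X θ v l h := by
  induction l with
  | zero => simp [layerDeriv]
  | succ l ih =>
    ext a b
    simp only [layerDeriv, ih, weight_smul, Matrix.smul_mul, Matrix.mul_smul, Matrix.of_apply,
      Matrix.add_apply, Matrix.smul_apply, smul_eq_mul]
    ring

theorem norm_layer_le (hγ : γ ≤ 1) (hβ : 0 ≤ β) (hσ : IsActivation γ β σ)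
    (hθ : ∀ i : Fin L, opNorm (weight θ i) ≤ w i) (l : ℕ) (h : l ≤ L) :
    ‖layer σ X θ l h‖ ≤ ‖X‖ * ∏ p ∈ Finset.range l, w p := by
  induction l with
  | zero => simp [layer]
  | succ l ih =>
    rw [layer_succ, Finset.prod_range_succ, ← mul_assoc]
    refine (norm_le_of_abs_le fun i j => (hσ.act hγ hβ L l).abs_le _).trans
      ((norm_mul_le_norm_mul_opNorm _ _).trans ?_)
    have := ih (Nat.le_of_succ_le h)
    exact mul_le_mul this (hθ ⟨l, h⟩) (opNorm_nonneg _) ((norm_nonneg _).trans this)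

/-- The inductive step of the product rule: perturbing one factor at a time replaces some `w p` by
`d p` in `∏ w`, which gives the form `(∏ w) * ∑ d / w` of the first-order bounds below. -/
theorem norm_mul_add_mul_le {k m n : ℕ} {x P S ω δ : ℝ} {A F : Matrix (Fin k) (Fin m) ℝ}
    {W V : Matrix (Fin m) (Fin n) ℝ} (hω : 0 < ω) (hA : ‖A‖ ≤ x * P * S) (hF : ‖F‖ ≤ x * P)
    (hW : opNorm W ≤ ω) (hV : ‖V‖ ≤ δ) : ‖A * W + F * V‖ ≤ x * (P * ω) * (S + δ / ω) := by
  calc ‖A * W + F * V‖ ≤ ‖A‖ * opNorm W + ‖F‖ * ‖V‖ :=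
        (norm_add_le _ _).trans (add_le_add (norm_mul_le_norm_mul_opNorm _ _)
          (Matrix.frobenius_norm_mul _ _))
    _ ≤ x * P * S * ω + x * P * δ := add_le_add
        (mul_le_mul hA hW (opNorm_nonneg _) ((norm_nonneg _).trans hA))
        (mul_le_mul hF hV (norm_nonneg _) ((norm_nonneg _).trans hF))
    _ = _ := by field_simp

theorem norm_layerDeriv_le (hγ₀ : 0 ≤ γ) (hγ : γ ≤ 1) (hβ : 0 ≤ β) (hσ : IsActivation γ β σ)
    (hw : ∀ p, 0 < w p) (hθ : ∀ i : Fin L, opNorm (weight θ i) ≤ w i)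
    (hv : ∀ i : Fin L, ‖weight v i‖ ≤ d i) (l : ℕ) (h : l ≤ L) :
    ‖layerDeriv σ X θ v l h‖ ≤
      ‖X‖ * (∏ p ∈ Finset.range l, w p) * ∑ p ∈ Finset.range l, d p / w p := by
  induction l with
  | zero => simp [layerDeriv]
  | succ l ih =>
    rw [Finset.prod_range_succ, Finset.sum_range_succ]
    refine le_trans ?_ (norm_mul_add_mul_le (hw l) (ih (Nat.le_of_succ_le h))
      (norm_layer_le hγ hβ hσ hθ l (Nat.le_of_succ_le h)) (hθ ⟨l, h⟩) (hv ⟨l, h⟩))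
    refine norm_le_of_abs_le fun i j => ?_
    have := (hσ.act hγ hβ L l).deriv_mem
      ((layer σ X θ l (Nat.le_of_succ_le h) * weight θ ⟨l, h⟩) i j)
    rw [layerDeriv, Matrix.of_apply, abs_mul, abs_of_nonneg (hγ₀.trans this.1)]
    exact mul_le_of_le_one_left (abs_nonneg _) this.2

theorem norm_preact_sub_le (hγ : γ ≤ 1) (hβ : 0 ≤ β) (hσ : IsActivation γ β σ)
    (hw : ∀ p, 0 < w p) (hθ : ∀ i : Fin L, opNorm (weight θ i) ≤ w i)
    (hθ' : ∀ i : Fin L, opNorm (weight (θ + v) i) ≤ w i)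
    (hv : ∀ i : Fin L, ‖weight v i‖ ≤ d i) {l : ℕ} (h : l + 1 ≤ L)
    (hD : ‖layer σ X (θ + v) l (Nat.le_of_succ_le h) - layer σ X θ l (Nat.le_of_succ_le h)‖ ≤
      ‖X‖ * (∏ p ∈ Finset.range l, w p) * ∑ p ∈ Finset.range l, d p / w p) :
    ‖layer σ X (θ + v) l (Nat.le_of_succ_le h) * weight (θ + v) ⟨l, h⟩ -
        layer σ X θ l (Nat.le_of_succ_le h) * weight θ ⟨l, h⟩‖ ≤
      ‖X‖ * (∏ p ∈ Finset.range (l + 1), w p) * ∑ p ∈ Finset.range (l + 1), d p / w p := by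
  rw [Finset.prod_range_succ, Finset.sum_range_succ]
  refine le_of_eq_of_le (congrArg _ ?_) (norm_mul_add_mul_le (hw l) hD
    (norm_layer_le hγ hβ hσ hθ l (Nat.le_of_succ_le h)) (hθ' ⟨l, h⟩) (hv ⟨l, h⟩))
  -- The splitting is `F' W' - F W = (F' - F) W' + F (W' - W)`.
  rw [weight_add, Matrix.sub_mul, Matrix.mul_add, Matrix.mul_add]
  abel

theorem norm_layer_sub_le (hγ₀ : 0 ≤ γ) (hγ : γ ≤ 1) (hβ : 0 ≤ β) (hσ : IsActivation γ β σ)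
    (hw : ∀ p, 0 < w p) (hθ : ∀ i : Fin L, opNorm (weight θ i) ≤ w i)
    (hθ' : ∀ i : Fin L, opNorm (weight (θ + v) i) ≤ w i)
    (hv : ∀ i : Fin L, ‖weight v i‖ ≤ d i) (l : ℕ) (h : l ≤ L) :
    ‖layer σ X (θ + v) l h - layer σ X θ l h‖ ≤
      ‖X‖ * (∏ p ∈ Finset.range l, w p) * ∑ p ∈ Finset.range l, d p / w p := by
  induction l with
  | zero => simp [layer]
  | succ l ih =>
    refine le_trans ?_ (norm_preact_sub_le hγ hβ hσ hw hθ hθ' hv h (ih (Nat.le_of_succ_le h)))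
    rw [layer_succ, layer_succ]
    exact norm_le_of_abs_le fun i j => (hσ.act hγ hβ L l).abs_sub_le hγ₀ _ _

/-- The remainder has two sources: the scalar Taylor error of the activation at the exact change of
its input, and the second-order part of that change, namely the propagated remainder plus the cross
term `(F' - F) V`. -/
theorem layer_succ_remainder (θ v : Params L n) {l : ℕ} (h : l + 1 ≤ L) (i : Fin N)
    (j : Fin (n (l + 1))) :
    let F := layer σ X θ l (Nat.le_of_succ_le h)
    let F' := layer σ X (θ + v) l (Nat.le_of_succ_le h)
    let T := layerDeriv σ X θ v l (Nat.le_of_succ_le h)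
    let W := weight θ ⟨l, h⟩
    let W' := weight (θ + v) ⟨l, h⟩
    (layer σ X (θ + v) (l + 1) h - layer σ X θ (l + 1) h - layerDeriv σ X θ v (l + 1) h) i j =
      (act L σ l ((F' * W') i j) - act L σ l ((F * W) i j) -
        deriv (act L σ l) ((F * W) i j) * ((F' * W') i j - (F * W) i j)) +
      deriv (act L σ l) ((F * W) i j) *
        ((F' - F - T) * W + (F' - F) * weight v ⟨l, h⟩) i j := by
  intro F F' T W W'
  have : (F' - F - T) * W + (F' - F) * weight v ⟨l, h⟩ =
      F' * W' - F * W - (T * W + F * weight v ⟨l, h⟩) := by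
    simp only [W', W, weight_add, Matrix.sub_mul, Matrix.mul_add]
    abel
  rw [this, layer_succ, layer_succ, layerDeriv]
  simp only [Matrix.sub_apply, Matrix.map_apply, Matrix.of_apply, F, F', T, W, W']
  ring

/-- With `y = ‖X‖ ∏ M`, each layer contributes one activation error of order `β y²`, hence the
factor `l * β`. The condition `M ≥ 1` makes `y` nondecreasing in `l` and lets the quotients `d / M`
be replaced by `d`. -/
theorem norm_layer_sub_sub_layerDeriv_le (hγ₀ : 0 ≤ γ) (hγ : γ ≤ 1) (hβ : 0 ≤ β)
    (hσ : IsActivation γ β σ) (hM : ∀ p, 1 ≤ M p)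
    (hθ : ∀ i : Fin L, opNorm (weight θ i) ≤ M i)
    (hθ' : ∀ i : Fin L, opNorm (weight (θ + v) i) ≤ M i) (hd : ∀ p, 0 ≤ d p)
    (hv : ∀ i : Fin L, ‖weight v i‖ ≤ d i) (l : ℕ) (h : l ≤ L) :
    ‖layer σ X (θ + v) l h - layer σ X θ l h - layerDeriv σ X θ v l h‖ ≤
      ‖X‖ * (∏ p ∈ Finset.range l, M p) *
        (1 + l * β * (‖X‖ * ∏ p ∈ Finset.range l, M p)) / 2 *
        (∑ p ∈ Finset.range l, d p) ^ 2 := by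
  have hM₀ : ∀ p, 0 < M p := fun p => one_pos.trans_le (hM p)
  have hdM : ∀ l, ∑ p ∈ Finset.range l, d p / M p ≤ ∑ p ∈ Finset.range l, d p := fun l =>
    Finset.sum_le_sum fun p _ => div_le_self (hd p) (hM p)
  induction l with
  | zero => simp [layer, layerDeriv]
  | succ l ih =>
    have hl := Nat.le_of_succ_le h
    set x := ‖X‖ with hx
    have hx₀ : 0 ≤ x := norm_nonneg _
    set P := ∏ p ∈ Finset.range l, M p with hP
    have hP₀ : 0 ≤ P := Finset.prod_nonneg fun p _ => (hM₀ p).le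
    set S := ∑ p ∈ Finset.range l, d p with hS
    have hS₀ : 0 ≤ S := Finset.sum_nonneg fun p _ => hd p
    have hD := norm_layer_sub_le (X := X) hγ₀ hγ hβ hσ hM₀ hθ hθ' hv l hl
    have hG := norm_preact_sub_le hγ hβ hσ hM₀ hθ hθ' hv h hD
    have hD' : ‖layer σ X (θ + v) l hl - layer σ X θ l hl‖ ≤ x * P * S :=
      hD.trans (by gcongr; exact hdM l)
    have hG' : ‖layer σ X (θ + v) l hl * weight (θ + v) ⟨l, h⟩ -
        layer σ X θ l hl * weight θ ⟨l, h⟩‖ ≤ x * (P * M l) * (S + d l) := by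
      refine hG.trans ?_
      rw [Finset.prod_range_succ, ← hP, ← hx]
      have := hdM (l + 1)
      rw [Finset.sum_range_succ (fun p => d p) l] at this
      have := hM₀ l
      gcongr
    rw [Finset.prod_range_succ, Finset.sum_range_succ, ← hP, ← hS]
    have hE := ih hl
    set E := layer σ X (θ + v) l hl - layer σ X θ l hl - layerDeriv σ X θ v l hl
    set D := layer σ X (θ + v) l hl - layer σ X θ l hl
    have hsplit : layer σ X (θ + v) (l + 1) h - layer σ X θ (l + 1) h -
        layerDeriv σ X θ v (l + 1) h =
        Matrix.of (fun i j => act L σ l ((layer σ X (θ + v) l hl * weight (θ + v) ⟨l, h⟩) i j) -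
          act L σ l ((layer σ X θ l hl * weight θ ⟨l, h⟩) i j) -
          deriv (act L σ l) ((layer σ X θ l hl * weight θ ⟨l, h⟩) i j) *
          ((layer σ X (θ + v) l hl * weight (θ + v) ⟨l, h⟩) i j -
            (layer σ X θ l hl * weight θ ⟨l, h⟩) i j)) +
        Matrix.of (fun i j => deriv (act L σ l) ((layer σ X θ l hl * weight θ ⟨l, h⟩) i j) *
          (E * weight θ ⟨l, h⟩ + D * weight v ⟨l, h⟩) i j) := by
      ext i j
      exact layer_succ_remainder θ v h i j
    rw [hsplit]
    have h₁ := norm_le_mul_sq_of_abs_le (A := Matrix.of (fun i j => act L σ l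
          ((layer σ X (θ + v) l hl * weight (θ + v) ⟨l, h⟩) i j) -
          act L σ l ((layer σ X θ l hl * weight θ ⟨l, h⟩) i j) -
          deriv (act L σ l) ((layer σ X θ l hl * weight θ ⟨l, h⟩) i j) *
          ((layer σ X (θ + v) l hl * weight (θ + v) ⟨l, h⟩) i j -
            (layer σ X θ l hl * weight θ ⟨l, h⟩) i j)))
      (B := layer σ X (θ + v) l hl * weight (θ + v) ⟨l, h⟩ -
        layer σ X θ l hl * weight θ ⟨l, h⟩) (c := β / 2) (by positivity)
      fun i j => (hσ.act hγ hβ L l).abs_taylor_le _ _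
    have h₂ : ‖Matrix.of (fun i j =>
        deriv (act L σ l) ((layer σ X θ l hl * weight θ ⟨l, h⟩) i j) *
          (E * weight θ ⟨l, h⟩ + D * weight v ⟨l, h⟩) i j)‖ ≤
        ‖E‖ * M l + ‖D‖ * d l := by
      refine (norm_le_of_abs_le (B := E * weight θ ⟨l, h⟩ + D * weight v ⟨l, h⟩)
        fun i j => ?_).trans ((norm_add_le _ _).trans (add_le_add
          ((norm_mul_le_norm_mul_opNorm _ _).trans ?_) ((Matrix.frobenius_norm_mul _ _).trans ?_)))
      · have := (hσ.act hγ hβ L l).deriv_mem ((layer σ X θ l hl * weight θ ⟨l, h⟩) i j)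
        rw [Matrix.of_apply, abs_mul, abs_of_nonneg (hγ₀.trans this.1)]
        exact mul_le_of_le_one_left (abs_nonneg _) this.2
      · exact mul_le_mul_of_nonneg_left (hθ ⟨l, h⟩) (norm_nonneg _)
      · exact mul_le_mul_of_nonneg_left (hv ⟨l, h⟩) (norm_nonneg _)
    have hdl := hd l
    have hMl := hM l
    have hMl₀ := hM₀ l
    calc _ ≤ β / 2 * (x * (P * M l) * (S + d l)) ^ 2 +
          (x * P * (1 + l * β * (x * P)) / 2 * S ^ 2 * M l + x * P * S * d l) := by
          refine (norm_add_le _ _).trans (add_le_add (h₁.trans ?_) (h₂.trans ?_))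
          · gcongr
          · gcongr
      _ ≤ β / 2 * (x * (P * M l) * (S + d l)) ^ 2 +
          (x * (P * M l) * (1 + l * β * (x * (P * M l))) / 2 * S ^ 2 +
            x * (P * M l) * S * d l) := by
          have hPM : P ≤ P * M l := le_mul_of_one_le_right hP₀ hMl
          have : x * P * (1 + l * β * (x * P)) / 2 * S ^ 2 * M l =
            x * (P * M l) * (1 + l * β * (x * P)) / 2 * S ^ 2 := by ring
          rw [this]
          gcongr
      _ ≤ _ := by
          have h₃ : 0 ≤ x * (P * M l) := by positivity
          generalize x * (P * M l) = y at h₃ ⊢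
          -- This quantity is exactly the right side minus the left side.
          have h₄ : 0 ≤ y * (1 + l * β * y) / 2 * d l ^ 2 + y * (l * β * y) * S * d l := by
            positivity
          push_cast
          nlinarith [h₄]

end Forward

/-! ### The loss and its gradient -/

section Gradient

open scoped Matrix.Norms.Frobenius Gradient

variable {N L : ℕ} {n : ℕ → ℕ} {γ β : ℝ} {σ : ℝ → ℝ} {X : Matrix (Fin N) (Fin (n 0)) ℝ}
  {Y : Matrix (Fin N) (Fin (n L)) ℝ} {θ v : Params L n} {w d M s : ℕ → ℝ}

theorem loss_nonneg (θ : Params L n) : 0 ≤ loss σ X Y θ := by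
  unfold loss; positivity

theorem norm_residual (θ : Params L n) :
    ‖layer σ X θ L le_rfl - Y‖ = √(2 * loss σ X Y θ) := by
  rw [loss, frobNorm, ← mul_assoc]
  norm_num

theorem loss_add (θ v : Params L n) :
    loss σ X Y (θ + v) - loss σ X Y θ -
        frobInner (layerDeriv σ X θ v L le_rfl) (layer σ X θ L le_rfl - Y) =
      frobInner (layer σ X (θ + v) L le_rfl - layer σ X θ L le_rfl - layerDeriv σ X θ v L le_rfl)
        (layer σ X θ L le_rfl - Y) +
      ‖layer σ X (θ + v) L le_rfl - layer σ X θ L le_rfl‖ ^ 2 / 2 := by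
  set F := layer σ X θ L le_rfl
  set F' := layer σ X (θ + v) L le_rfl
  set T := layerDeriv σ X θ v L le_rfl
  have h₁ := norm_add_sq_frobInner (F' - F) (F - Y)
  have h₂ := frobInner_add_left (F' - F - T) T (F - Y)
  rw [sub_add_cancel] at h₂
  rw [sub_add_sub_cancel] at h₁
  have h₃ : loss σ X Y (θ + v) = 1 / 2 * ‖F' - Y‖ ^ 2 := rfl
  have h₄ : loss σ X Y θ = 1 / 2 * ‖F - Y‖ ^ 2 := rfl
  rw [h₃, h₄]
  linarith

theorem abs_loss_remainder_le (hγ₀ : 0 ≤ γ) (hγ : γ ≤ 1) (hβ : 0 ≤ β)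
    (hσ : IsActivation γ β σ) (hw : ∀ p, 0 < w p)
    (hθw : ∀ i : Fin L, opNorm (weight θ i) ≤ w i)
    (hθw' : ∀ i : Fin L, opNorm (weight (θ + v) i) ≤ w i) (hM : ∀ p, 1 ≤ M p)
    (hθM : ∀ i : Fin L, opNorm (weight θ i) ≤ M i)
    (hθM' : ∀ i : Fin L, opNorm (weight (θ + v) i) ≤ M i) (hd : ∀ p, 0 ≤ d p)
    (hv : ∀ i : Fin L, ‖weight v i‖ ≤ d i) :
    |loss σ X Y (θ + v) - loss σ X Y θ -
        frobInner (layerDeriv σ X θ v L le_rfl) (layer σ X θ L le_rfl - Y)| ≤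
      ‖X‖ * (∏ p ∈ Finset.range L, M p) *
        (1 + L * β * (‖X‖ * ∏ p ∈ Finset.range L, M p)) / 2 *
        (∑ p ∈ Finset.range L, d p) ^ 2 * √(2 * loss σ X Y θ) +
      (‖X‖ * (∏ p ∈ Finset.range L, w p) * ∑ p ∈ Finset.range L, d p / w p) ^ 2 / 2 := by
  rw [loss_add]
  refine (abs_add_le _ _).trans (add_le_add ((abs_frobInner_le _ _).trans ?_) ?_)
  · rw [← norm_residual]
    gcongr
    exact norm_layer_sub_sub_layerDeriv_le hγ₀ hγ hβ hσ hM hθM hθM' hd hv L le_rfl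
  · rw [abs_of_nonneg (by positivity)]
    gcongr
    exact norm_layer_sub_le hγ₀ hγ hβ hσ hw hθw hθw' hv L le_rfl

/-- The differential of the loss at `θ`. -/
noncomputable def lossDeriv (σ : ℝ → ℝ) (X : Matrix (Fin N) (Fin (n 0)) ℝ)
    (Y : Matrix (Fin N) (Fin (n L)) ℝ) (θ : Params L n) : Params L n →L[ℝ] ℝ :=
  LinearMap.toContinuousLinearMap
    { toFun := fun v => frobInner (layerDeriv σ X θ v L le_rfl) (layer σ X θ L le_rfl - Y)
      map_add' := fun v v' => by rw [layerDeriv_add, frobInner_add_left]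
      map_smul' := fun c v => by rw [layerDeriv_smul, frobInner_smul_left]; rfl }

theorem lossDeriv_apply (θ v : Params L n) : lossDeriv σ X Y θ v =
    frobInner (layerDeriv σ X θ v L le_rfl) (layer σ X θ L le_rfl - Y) := rfl

theorem norm_weight_le (θ : Params L n) (i : Fin L) : ‖weight θ i‖ ≤ ‖θ‖ :=
  (norm_weight θ i).trans_le (PiLp.norm_apply_le θ i)

theorem hasFDerivAt_loss (hγ₀ : 0 ≤ γ) (hγ : γ ≤ 1) (hβ : 0 ≤ β) (hσ : IsActivation γ β σ)
    (θ : Params L n) : HasFDerivAt (loss σ X Y) (lossDeriv σ X Y θ) θ := by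
  rw [hasFDerivAt_iff_isLittleO_nhds_zero]
  -- The constant `2 + ‖θ‖` bounds the weights of `θ` and of `θ + v` for `‖v‖ ≤ 1`, and is at least
  -- 1, so it can serve as both families of bounds.
  have hM : ∀ p : ℕ, (1 : ℝ) ≤ (fun _ => 2 + ‖θ‖) p := fun _ => by
    have := norm_nonneg θ
    dsimp only; linarith
  obtain ⟨K, hK⟩ : ∃ K : ℝ, ∀ v : Params L n, ‖v‖ ≤ 1 →
      |loss σ X Y (θ + v) - loss σ X Y θ - lossDeriv σ X Y θ v| ≤ K * ‖v‖ ^ 2 := by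
    set P := ∏ _p ∈ Finset.range L, (2 + ‖θ‖) with hP
    refine ⟨‖X‖ * P * (1 + L * β * (‖X‖ * P)) / 2 * L ^ 2 * √(2 * loss σ X Y θ) +
      (‖X‖ * P * (L / (2 + ‖θ‖))) ^ 2 / 2, fun v hv => ?_⟩
    have hθ : ∀ i : Fin L, opNorm (weight θ i) ≤ (fun _ : ℕ => 2 + ‖θ‖) i := fun i =>
      (opNorm_le_norm _).trans ((norm_weight_le θ i).trans (by simp))
    have hθ' : ∀ i : Fin L, opNorm (weight (θ + v) i) ≤ (fun _ : ℕ => 2 + ‖θ‖) i := fun i =>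
      (opNorm_le_norm _).trans ((norm_weight_le _ i).trans
        ((norm_add_le _ _).trans (by dsimp only; linarith)))
    refine (abs_loss_remainder_le hγ₀ hγ hβ hσ (fun p => one_pos.trans_le (hM p)) hθ hθ' hM
      hθ hθ' (d := fun _ => ‖v‖) (fun _ => norm_nonneg _) (norm_weight_le v)).trans (le_of_eq ?_)
    simp only [← hP, Finset.sum_const, Finset.card_range, nsmul_eq_mul]
    ring
  refine Asymptotics.IsBigO.trans_isLittleO (g := fun v : Params L n => ‖v‖ ^ 2) ?_
    (Asymptotics.isLittleO_norm_pow_id one_lt_two)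
  refine Asymptotics.IsBigO.of_bound K ?_
  filter_upwards [Metric.ball_mem_nhds (0 : Params L n) one_pos] with v hv
  rw [Real.norm_eq_abs, Real.norm_eq_abs, abs_of_nonneg (sq_nonneg ‖v‖)]
  exact hK v (by simpa using (Metric.mem_ball.mp hv).le)

theorem inner_gradient_loss (hγ₀ : 0 ≤ γ) (hγ : γ ≤ 1) (hβ : 0 ≤ β) (hσ : IsActivation γ β σ)
    (θ v : Params L n) : inner ℝ (∇ (loss σ X Y) θ) v =
      frobInner (layerDeriv σ X θ v L le_rfl) (layer σ X θ L le_rfl - Y) := by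
  rw [← InnerProductSpace.toDual_apply_apply, toDual_gradient,
    (hasFDerivAt_loss hγ₀ hγ hβ hσ θ).fderiv, lossDeriv_apply]

/-- The parameter whose only nonzero layer is `a`, in position `i`. -/
noncomputable def single (i : Fin L) (a : EuclideanSpace ℝ (Fin (n i) × Fin (n (i + 1)))) :
    Params L n :=
  WithLp.toLp 2 (Pi.single i a)

theorem single_same (i : Fin L) (a : EuclideanSpace ℝ (Fin (n i) × Fin (n (i + 1)))) :
    (single i a : Params L n) i = a := by
  simp [single]

theorem single_of_ne {i j : Fin L} (a : EuclideanSpace ℝ (Fin (n i) × Fin (n (i + 1))))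
    (h : j ≠ i) : (single i a : Params L n) j = 0 := by
  simp [single, h]

theorem inner_single (θ : Params L n) (i : Fin L)
    (a : EuclideanSpace ℝ (Fin (n i) × Fin (n (i + 1)))) :
    inner ℝ θ (single i a) = inner ℝ (θ i) a := by
  rw [PiLp.inner_apply, Finset.sum_eq_single i]
  · rw [single_same]
  · intro j _ hj
    rw [single_of_ne a hj, inner_zero_right]
  · simp

/-- The gradient is tested against its own block `i`. Only one weight then varies, so the sum in
`norm_layerDeriv_le` has a single term, and one factor `‖g i‖` cancels. -/
theorem norm_gradient_apply_le (hγ₀ : 0 ≤ γ) (hγ : γ ≤ 1) (hβ : 0 ≤ β) (hσ : IsActivation γ β σ)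
    (hw : ∀ p, 0 < w p) (hθ : ∀ i : Fin L, opNorm (weight θ i) ≤ w i) (i : Fin L) :
    ‖∇ (loss σ X Y) θ i‖ ≤
      ‖X‖ * ((∏ p ∈ Finset.range L, w p) / w i) * √(2 * loss σ X Y θ) := by
  set g := ∇ (loss σ X Y) θ with hg
  have h₁ := inner_gradient_loss (X := X) (Y := Y) hγ₀ hγ hβ hσ θ (single i (g i))
  rw [inner_single, ← hg, real_inner_self_eq_norm_sq] at h₁
  have h₂ := (le_abs_self _).trans (abs_frobInner_le
    (layerDeriv σ X θ (single i (g i)) L le_rfl) (layer σ X θ L le_rfl - Y))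
  rw [← h₁, norm_residual] at h₂
  have h₃ := norm_layerDeriv_le (X := X) hγ₀ hγ hβ hσ hw hθ (v := single i (g i))
    (d := fun p => if p = i then ‖g i‖ else 0) (fun j => by
      rw [norm_weight]
      split_ifs with h
      · rw [Fin.val_inj] at h
        rw [h, single_same]
      · rw [single_of_ne _ (fun h' => h (by rw [h'])), norm_zero]) L le_rfl
  rw [Finset.sum_eq_single (i : ℕ) (fun p _ hp => by simp [hp]) (by simp), if_pos rfl] at h₃
  rcases (norm_nonneg (g i)).eq_or_lt with h₀ | h₀
  · rw [← h₀]
    have : 0 ≤ ∏ p ∈ Finset.range L, w p := Finset.prod_nonneg fun p _ => (hw p).le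
    have := hw i
    positivity
  · refine le_of_mul_le_mul_left ?_ h₀
    calc _ = ‖g i‖ ^ 2 := by ring
      _ ≤ _ := h₂
      _ ≤ _ := mul_le_mul_of_nonneg_right h₃ (Real.sqrt_nonneg _)
      _ = _ := by ring

/-! ### Lower bound for the gradient by backpropagation -/

/-- Lower bound on the derivative of the activation producing layer `l + 1`. -/
noncomputable def actLower (L : ℕ) (γ : ℝ) (l : ℕ) : ℝ := if l + 1 = L then 1 else γ

theorem actLower_pos (hγ : 0 < γ) (l : ℕ) : 0 < actLower L γ l := by
  unfold actLower; split_ifs <;> positivity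

theorem actLower_le_deriv (hσ : IsActivation γ β σ) (l : ℕ) (x : ℝ) :
    actLower L γ l ≤ deriv (act L σ l) x := by
  unfold actLower act
  split_ifs
  · simp
  · exact (hσ.deriv_mem x).1

theorem frobInner_of_mul {m k : ℕ} (D A B : Matrix (Fin m) (Fin k) ℝ) :
    frobInner (Matrix.of fun a b => D a b * A a b) B =
      frobInner A (Matrix.of fun a b => D a b * B a b) := by
  simp only [frobInner, Matrix.of_apply]
  exact Finset.sum_congr rfl fun i _ => Finset.sum_congr rfl fun j _ => by ring

/-- `B` is the image of `e` under the adjoint of the derivative restricted to the second weight.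
Passing down a layer multiplies entrywise by the activation derivative and then by `Wᵀ`; at the
bottom comes `F₁ᵀ`. Each step has a lower bound, and `e` varies in the induction because it is
replaced at each layer. -/
theorem exists_backprop (hγ : 0 < γ) (hσ : IsActivation γ β σ) (hL : 2 ≤ L) {sF : ℝ}
    (hsF : 0 ≤ sF) (hF : ExpandsBy (layer σ X θ 1 (by omega)).transpose sF)
    (hs : ∀ p, 0 ≤ s p) (hW : ∀ i : Fin L, 2 ≤ (i : ℕ) → ExpandsBy (weight θ i) (s i))
    (l : ℕ) (hl : 2 ≤ l) (h : l ≤ L) (e : Matrix (Fin N) (Fin (n l)) ℝ) :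
    ∃ B : Matrix (Fin (n 1)) (Fin (n 2)) ℝ,
      sF * actLower L γ 1 * (∏ p ∈ Finset.Ico 2 l, s p * actLower L γ p) * ‖e‖ ≤ ‖B‖ ∧
      ∀ v : Params L n, (∀ i : Fin L, (i : ℕ) ≠ 1 → weight v i = 0) →
        frobInner (layerDeriv σ X θ v l h) e = frobInner (weight v ⟨1, by omega⟩) B := by
  induction l, hl using Nat.le_induction with
  | base =>
    set D : Matrix (Fin N) (Fin (n 2)) ℝ := Matrix.of fun a b =>
      deriv (act L σ 1) ((layer σ X θ 1 (by omega) * weight θ ⟨1, by omega⟩) a b)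
    set E : Matrix (Fin N) (Fin (n 2)) ℝ := Matrix.of fun a b => D a b * e a b
    refine ⟨(layer σ X θ 1 (by omega)).transpose * E, ?_, fun v hv => ?_⟩
    · have h₁ : actLower L γ 1 * ‖e‖ ≤ ‖E‖ := mul_norm_le_of_le_abs (actLower_pos hγ 1)
        fun i j => by
          have h₂ := actLower_le_deriv (L := L) hσ 1
            ((layer σ X θ 1 (by omega) * weight θ ⟨1, by omega⟩) i j)
          have h₃ := actLower_pos (L := L) hγ 1
          simp only [E, D, Matrix.of_apply, abs_mul, abs_of_pos (h₃.trans_le h₂)]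
          exact mul_le_mul_of_nonneg_right h₂ (abs_nonneg _)
      have h₂ := hF.mul_norm_le hsF E.transpose
      rw [← Matrix.transpose_mul, Matrix.frobenius_norm_transpose,
        Matrix.frobenius_norm_transpose] at h₂
      rw [Finset.Ico_self, Finset.prod_empty, mul_one, mul_assoc]
      exact (mul_le_mul_of_nonneg_left h₁ hsF).trans h₂
    · have h₁ : layerDeriv σ X θ v 1 (by omega) = 0 := by
        ext a b
        simp [layerDeriv, hv ⟨0, by omega⟩ (by simp)]
      rw [← frobInner_mul_left]
      refine Eq.trans ?_ (frobInner_of_mul D _ e)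
      rw [layerDeriv, h₁, Matrix.zero_mul, zero_add]
      rfl
  | succ l hl ih =>
    have hl' := Nat.le_of_succ_le h
    set D : Matrix (Fin N) (Fin (n (l + 1))) ℝ := Matrix.of fun a b =>
      deriv (act L σ l) ((layer σ X θ l hl' * weight θ ⟨l, h⟩) a b)
    set E : Matrix (Fin N) (Fin (n (l + 1))) ℝ := Matrix.of fun a b => D a b * e a b
    obtain ⟨B, hB, hvB⟩ := ih hl' (E * (weight θ ⟨l, h⟩).transpose)
    refine ⟨B, ?_, fun v hv => ?_⟩
    · have h₁ : actLower L γ l * ‖e‖ ≤ ‖E‖ := mul_norm_le_of_le_abs (actLower_pos hγ l)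
        fun i j => by
          have h₂ := actLower_le_deriv (L := L) hσ l
            ((layer σ X θ l hl' * weight θ ⟨l, h⟩) i j)
          have h₃ := actLower_pos (L := L) hγ l
          simp only [E, D, Matrix.of_apply, abs_mul, abs_of_pos (h₃.trans_le h₂)]
          exact mul_le_mul_of_nonneg_right h₂ (abs_nonneg _)
      have h₂ := (hW ⟨l, h⟩ hl).mul_norm_le (hs l) E
      refine le_trans ?_ hB
      rw [Finset.prod_Ico_succ_top hl, ← mul_assoc _ _ (s l * _), mul_assoc _ (s l * _),
        mul_assoc (s l)]
      have h₃ : 0 ≤ ∏ p ∈ Finset.Ico 2 l, s p * actLower L γ p :=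
        Finset.prod_nonneg fun p _ => mul_nonneg (hs p) (actLower_pos hγ p).le
      have h₄ := actLower_pos (L := L) hγ 1
      exact mul_le_mul_of_nonneg_left ((mul_le_mul_of_nonneg_left h₁ (hs l)).trans h₂)
        (by positivity)
    · rw [← hvB v hv, ← frobInner_mul_right]
      refine Eq.trans ?_ (frobInner_of_mul D _ e)
      rw [layerDeriv, hv ⟨l, h⟩ (by simp; omega), Matrix.mul_zero, add_zero]
      rfl

/-- Testing the gradient against the parameter `u` with second weight `B` and all others zero gives
`‖B‖² ≤ ‖∇Φ‖ ‖B‖`, where `B` is the backpropagated residual. -/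
theorem le_norm_gradient (hγ : 0 < γ) (hγ₁ : γ ≤ 1) (hβ : 0 ≤ β) (hσ : IsActivation γ β σ)
    (hL : 2 ≤ L) {sF : ℝ}
    (hsF : 0 ≤ sF) (hF : ExpandsBy (layer σ X θ 1 (by omega)).transpose sF)
    (hs : ∀ p, 0 ≤ s p) (hW : ∀ i : Fin L, 2 ≤ (i : ℕ) → ExpandsBy (weight θ i) (s i)) :
    sF * γ ^ (L - 2) * (∏ p ∈ Finset.Ico 2 L, s p) * √(2 * loss σ X Y θ) ≤
      ‖∇ (loss σ X Y) θ‖ := by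
  obtain ⟨B, hB, hvB⟩ := exists_backprop hγ hσ hL hsF hF hs hW L hL le_rfl
    (layer σ X θ L le_rfl - Y)
  have hprod : sF * actLower L γ 1 * (∏ p ∈ Finset.Ico 2 L, s p * actLower L γ p) =
      sF * γ ^ (L - 2) * ∏ p ∈ Finset.Ico 2 L, s p := by
    -- Of the `L - 1` activations after the first, the one at the output is the identity and costs
    -- no factor `γ`.
    have : actLower L γ 1 * ∏ p ∈ Finset.Ico 2 L, actLower L γ p = γ ^ (L - 2) := by
      rw [← Finset.prod_eq_prod_Ico_succ_bot (show 1 < L by omega)]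
      obtain ⟨K, rfl⟩ : ∃ K, L = K + 1 := ⟨L - 1, by omega⟩
      rw [Finset.prod_Ico_succ_top (by omega), actLower, if_pos rfl, mul_one,
        Finset.prod_congr rfl (g := fun _ => γ) fun p hp => by
          rw [actLower, if_neg (by have := Finset.mem_Ico.mp hp; omega)]]
      simp
    rw [Finset.prod_mul_distrib, ← this]; ring
  rw [hprod, norm_residual] at hB
  refine hB.trans ?_
  let a : EuclideanSpace ℝ (Fin (n 1) × Fin (n 2)) := WithLp.toLp 2 fun p => B p.1 p.2
  have ha : ‖a‖ = ‖B‖ := (norm_eq_norm_toLp B).symm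
  let i : Fin L := ⟨1, by omega⟩
  let u : Params L n := single i a
  have hu : weight u i = B := by
    ext p q
    simp only [weight, u, single_same, Matrix.of_apply]
    rfl
  have hu' : ∀ j : Fin L, (j : ℕ) ≠ 1 → weight u j = 0 := fun j hj => by
    ext p q
    simp [weight, u, single_of_ne (i := i) (j := j) a (fun h => hj (by rw [h]))]
  have h₁ := inner_gradient_loss (X := X) (Y := Y) hγ.le hγ₁ hβ hσ θ u
  rw [hvB u hu', hu, frobInner_self] at h₁
  have h₂ := real_inner_le_norm (∇ (loss σ X Y) θ) u
  have h₃ : ‖u‖ = ‖B‖ := by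
    rw [← ha, ← sq_eq_sq₀ (norm_nonneg _) (norm_nonneg _), ← real_inner_self_eq_norm_sq,
      inner_single, single_same, real_inner_self_eq_norm_sq]
  rw [h₁, h₃] at h₂
  rcases (norm_nonneg B).eq_or_lt with h₀ | h₀
  · rw [← h₀]; positivity
  · exact le_of_mul_le_mul_right (by rwa [← sq]) h₀

end Gradient

/-! ### Quantities at initialization -/

section Initialization

open scoped Matrix.Norms.Frobenius

variable {N L : ℕ} {n : ℕ → ℕ} {γ β : ℝ} {σ : ℝ → ℝ} {X : Matrix (Fin N) (Fin (n 0)) ℝ}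
  {Y : Matrix (Fin N) (Fin (n L)) ℝ} {θ₀ θ : Params L n}

/-- Extension of a family indexed by `Fin L` to the natural numbers by a constant. -/
noncomputable def natExt (f : Fin L → ℝ) (c : ℝ) (p : ℕ) : ℝ := if h : p < L then f ⟨p, h⟩ else c

theorem natExt_val (f : Fin L → ℝ) (c : ℝ) (i : Fin L) : natExt f c i = f i := by
  simp [natExt]

theorem natExt_prop {f : Fin L → ℝ} {c : ℝ} {Q : ℝ → Prop} (hf : ∀ i, Q (f i)) (hc : Q c) (p : ℕ) :
    Q (natExt f c p) := by
  unfold natExt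
  split_ifs
  exacts [hf _, hc]

theorem prod_range_natExt (f : Fin L → ℝ) (c : ℝ) :
    ∏ p ∈ Finset.range L, natExt f c p = ∏ i, f i := by
  simp [Finset.prod_range, natExt_val]

theorem sum_range_natExt (f : Fin L → ℝ) (c : ℝ) :
    ∑ p ∈ Finset.range L, natExt f c p = ∑ i, f i := by
  simp [Finset.sum_range, natExt_val]

theorem prod_Ico_two_eq (f : ℕ → ℝ) :
    ∏ p ∈ Finset.Ico 2 L, f p = ∏ i ∈ Finset.univ.filter (fun i : Fin L => 2 ≤ (i : ℕ)), f i := by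
  rw [Finset.prod_filter, ← Finset.prod_range (fun p => if 2 ≤ p then f p else 1),
    ← Finset.prod_filter]
  congr 1
  ext p
  simp [and_comm]

theorem prod_univ_eq_mul_mul (hL : 2 ≤ L) (f : Fin L → ℝ) :
    ∏ i, f i = f ⟨0, by omega⟩ * f ⟨1, by omega⟩ *
      ∏ i ∈ Finset.univ.filter (fun i : Fin L => 2 ≤ (i : ℕ)), f i := by
  have h := prod_Ico_two_eq (L := L) (natExt f 1)
  simp only [natExt_val] at h
  rw [← h, ← prod_range_natExt f 1, Finset.range_eq_Ico,
    Finset.prod_eq_prod_Ico_succ_bot (by omega), Finset.prod_eq_prod_Ico_succ_bot (by omega),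
    mul_assoc]
  simp [natExt, show 0 < L by omega, show 1 < L by omega]

theorem svMin_nonneg {m k : ℕ} (A : Matrix (Fin m) (Fin k) ℝ) : 0 ≤ svMin A :=
  LinearMap.singularValues_nonneg _ _

theorem pos_of_svMin_pos {m k : ℕ} {A : Matrix (Fin m) (Fin k) ℝ} (h : 0 < svMin A) : 0 < k := by
  rcases k.eq_zero_or_pos with rfl | hk
  · rw [svMin, LinearMap.singularValues_of_finrank_le _ (by simp)] at h
    exact absurd h (lt_irrefl _)
  · exact hk

theorem lam_le_opNorm (hn : IsPyramidal N L n) {i : Fin L} (hi : 2 ≤ (i : ℕ))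
    (hlam : 0 < lam θ₀ i) : lam θ₀ i ≤ opNorm (weight θ₀ i) :=
  (expandsBy_svMin (hn.2 i hi i.2) (weight θ₀ i)).le_opNorm (pos_of_svMin_pos hlam)

theorem lamBar_pos (hn : IsPyramidal N L n)
    (hlam : ∀ i : Fin L, 2 ≤ (i : ℕ) → 0 < lam θ₀ i) (i : Fin L) : 0 < lamBar θ₀ i := by
  unfold lamBar
  split_ifs with h
  · have := opNorm_nonneg (weight θ₀ i)
    positivity
  · exact (hlam i (by omega)).trans_le (lam_le_opNorm hn (by omega) (hlam i (by omega)))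

/-! ### The trapping region and the initial conditions -/

/-- Upper bounds `(3/2) λ̄` for the spectral norms of the weights during training. -/
noncomputable def weightBound (θ₀ : Params L n) : ℕ → ℝ := natExt (fun i => 3 / 2 * lamBar θ₀ i) 1

theorem weightBound_val (θ₀ : Params L n) (i : Fin L) :
    weightBound θ₀ i = 3 / 2 * lamBar θ₀ i := natExt_val _ _ i

theorem weightBound_pos (hb : ∀ i, 0 < lamBar θ₀ i) (p : ℕ) : 0 < weightBound θ₀ p :=
  natExt_prop (Q := fun x => 0 < x) (fun i => by have := hb i; positivity) one_pos p

theorem prod_weightBound (θ₀ : Params L n) :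
    ∏ p ∈ Finset.range L, weightBound θ₀ p = (3 / 2) ^ L * lamBarProd θ₀ := by
  rw [weightBound, prod_range_natExt, Finset.prod_mul_distrib]
  rw [Finset.prod_const, Finset.card_univ, Fintype.card_fin, lamBarProd]

/-- Upper bound, relative to `√(2Φ)`, for the gradient with respect to layer `i + 1`. -/
noncomputable def gradBound (X : Matrix (Fin N) (Fin (n 0)) ℝ) (θ₀ : Params L n) (i : Fin L) : ℝ :=
  ‖X‖ * ((∏ p ∈ Finset.range L, weightBound θ₀ p) / weightBound θ₀ i)

theorem gradBound_nonneg (hb : ∀ i, 0 < lamBar θ₀ i) (i : Fin L) : 0 ≤ gradBound X θ₀ i := by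
  have h := weightBound_pos hb
  have : 0 ≤ ∏ p ∈ Finset.range L, weightBound θ₀ p := Finset.prod_nonneg fun p _ => (h p).le
  have := h i
  unfold gradBound
  positivity

/-- Radius of the ball around the initial value in which layer `i + 1` stays. -/
noncomputable def radius (hL : 2 ≤ L) (γ : ℝ) (σ : ℝ → ℝ) (X : Matrix (Fin N) (Fin (n 0)) ℝ)
    (Y : Matrix (Fin N) (Fin (n L)) ℝ) (θ₀ : Params L n) (i : Fin L) : ℝ :=
  gradBound X θ₀ i * √(2 * loss σ X Y θ₀) * (2 / α₀ hL γ σ X θ₀)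

theorem lamTop_pos (hlam : ∀ i : Fin L, 2 ≤ (i : ℕ) → 0 < lam θ₀ i) : 0 < lamTop θ₀ :=
  Finset.prod_pos fun i hi => hlam i (Finset.mem_filter.mp hi).2

theorem lamBarTop_pos (hb : ∀ i, 0 < lamBar θ₀ i) : 0 < lamBarTop θ₀ :=
  Finset.prod_pos fun i _ => hb i

theorem α₀_pos (hL : 2 ≤ L) (hγ : 0 < γ) (hF : 0 < lamF hL σ X θ₀) (hT : 0 < lamTop θ₀) :
    0 < α₀ hL γ σ X θ₀ := by
  unfold α₀; positivity

theorem Q₁_eq (hL : 2 ≤ L) (hb : ∀ i, 0 < lamBar θ₀ i) :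
    Q₁ hL γ σ X Y θ₀ =
      (∑ i, gradBound X θ₀ i) * √(2 * loss σ X Y θ₀) * (2 / α₀ hL γ σ X θ₀) := by
  have : ∀ i, gradBound X θ₀ i = ‖X‖ * (3 / 2) ^ L * (2 / 3) * (lamBarProd θ₀ / lamBar θ₀ i) :=
    fun i => by
      rw [gradBound, prod_weightBound, weightBound_val]
      have := hb i
      field_simp
  simp only [this, ← Finset.mul_sum]
  rw [Q₁, show frobNorm X = ‖X‖ from rfl]
  ring

/-- This puts the radius in the shape of the initial conditions: `(3/2)^L / (γ²/4)^L = (6/γ²)^L`,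
and `2 * (2/3) * (γ⁴/4) = γ⁴/3`. -/
theorem radius_eq (hL : 2 ≤ L) (hγ : 0 < γ) (hF : 0 < lamF hL σ X θ₀) (hT : 0 < lamTop θ₀)
    (hb : ∀ i, 0 < lamBar θ₀ i) (i : Fin L) :
    radius hL γ σ X Y θ₀ i = γ ^ 4 / 3 * (6 / γ ^ 2) ^ L * ‖X‖ * √(2 * loss σ X Y θ₀) *
      (lamBarTop θ₀ / lamTop θ₀ ^ 2) *
      (lamBar θ₀ ⟨0, by omega⟩ * lamBar θ₀ ⟨1, by omega⟩ / lamBar θ₀ i) /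
      lamF hL σ X θ₀ ^ 2 := by
  have hi := hb i
  have h₁ : lamBarProd θ₀ = lamBar θ₀ ⟨0, by omega⟩ * lamBar θ₀ ⟨1, by omega⟩ * lamBarTop θ₀ :=
    prod_univ_eq_mul_mul hL _
  have h₂ : (6 / γ ^ 2) ^ L = (3 / 2) ^ L / (γ ^ 2 / 4) ^ L := by
    rw [← div_pow]; congr 1; field_simp; norm_num
  rw [radius, gradBound, prod_weightBound, weightBound_val, α₀, h₁, h₂]
  generalize √(2 * loss σ X Y θ₀) = q
  generalize (3 / 2 : ℝ) ^ L = a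
  have hc : 0 < (γ ^ 2 / 4) ^ L := by positivity
  generalize (γ ^ 2 / 4) ^ L = c at hc ⊢
  field_simp
  ring

theorem minLamTop_le (i : Fin L) (hi : 2 ≤ (i : ℕ)) :
    minLamTop θ₀ ≤ lam θ₀ i * lamBar θ₀ i :=
  ciInf_le (f := fun i : {i : Fin L // 2 ≤ (i : ℕ)} => lam θ₀ i * lamBar θ₀ i)
    (Set.finite_range _).bddBelow ⟨i, hi⟩

theorem minLamTop_pos (hlam : ∀ i : Fin L, 2 ≤ (i : ℕ) → 0 < lam θ₀ i)
    (hb : ∀ i, 0 < lamBar θ₀ i) (i : Fin L) (hi : 2 ≤ (i : ℕ)) : 0 < minLamTop θ₀ := by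
  have : Nonempty {i : Fin L // 2 ≤ (i : ℕ)} := ⟨⟨i, hi⟩⟩
  obtain ⟨j, hj⟩ := exists_eq_ciInf_of_finite
    (f := fun i : {i : Fin L // 2 ≤ (i : ℕ)} => lam θ₀ i * lamBar θ₀ i)
  rw [minLamTop, ← hj]
  exact mul_pos (hlam _ j.2) (hb _)

theorem radius_le_one (hL : 2 ≤ L) (hγ : 0 < γ) (hF : 0 < lamF hL σ X θ₀) (hT : 0 < lamTop θ₀)
    (hb : ∀ i, 0 < lamBar θ₀ i) (hinit : InitCond₁ hL γ σ X Y θ₀) (i : Fin L) (hi : (i : ℕ) < 2) :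
    radius hL γ σ X Y θ₀ i ≤ 1 := by
  rw [radius_eq hL hγ hF hT hb, div_le_one (by positivity)]
  refine le_trans ?_ hinit
  have hBT := lamBarTop_pos hb
  have h₀ := hb ⟨0, by omega⟩
  have h₁ := hb ⟨1, by omega⟩
  change _ ≤ γ ^ 4 / 3 * (6 / γ ^ 2) ^ L * ‖X‖ * _ * _ * _
  gcongr
  obtain hi' | hi' : (i : ℕ) = 0 ∨ (i : ℕ) = 1 := by omega
  · rw [show i = ⟨0, by omega⟩ from Fin.ext hi', mul_div_cancel_left₀ _ h₀.ne']
    exact (le_max_right _ _).trans (le_max_right _ _)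
  · rw [show i = ⟨1, by omega⟩ from Fin.ext hi', mul_div_cancel_right₀ _ h₁.ne']
    exact (le_max_left _ _).trans (le_max_right _ _)

/-- This is the role of the first entry of the maximum. The layer `i` itself shows that the minimum
is over a nonempty set, so its default value at `L = 2` is never met. -/
theorem radius_le_lam (hL : 2 ≤ L) (hγ : 0 < γ) (hF : 0 < lamF hL σ X θ₀)
    (hlam : ∀ i : Fin L, 2 ≤ (i : ℕ) → 0 < lam θ₀ i)
    (hb : ∀ i, 0 < lamBar θ₀ i) (hinit : InitCond₁ hL γ σ X Y θ₀) (i : Fin L) (hi : 2 ≤ (i : ℕ)) :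
    radius hL γ σ X Y θ₀ i ≤ lam θ₀ i / 2 := by
  have hT := lamTop_pos hlam
  rw [radius_eq hL hγ hF hT hb, div_le_iff₀ (by positivity)]
  have hBT := lamBarTop_pos hb
  have h₀ := hb ⟨0, by omega⟩
  have h₁ := hb ⟨1, by omega⟩
  have hbi := hb i
  have hli := hlam i hi
  refine le_trans ?_ (mul_le_mul_of_nonneg_left hinit (by positivity))
  change _ ≤ lam θ₀ i / 2 * (γ ^ 4 / 3 * (6 / γ ^ 2) ^ L * ‖X‖ * _ * _ * _)
  rw [mul_left_comm]
  gcongr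
  have hmin := minLamTop_pos hlam hb i hi
  have hle := minLamTop_le (θ₀ := θ₀) i hi
  refine le_trans ?_ (mul_le_mul_of_nonneg_left (le_max_left _ _) (by positivity))
  calc _ = lam θ₀ i / 2 * (2 * lamBar θ₀ ⟨0, by omega⟩ * lamBar θ₀ ⟨1, by omega⟩ /
        (lam θ₀ i * lamBar θ₀ i)) := by field_simp
    _ ≤ _ := by gcongr

theorem opNorm_mul_radius_le (hL : 2 ≤ L) (hγ : 0 < γ) (hF : 0 < lamF hL σ X θ₀)
    (hT : 0 < lamTop θ₀) (hb : ∀ i, 0 < lamBar θ₀ i) (hinit : InitCond₂ hL γ σ X Y θ₀) :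
    opNorm X * radius hL γ σ X Y θ₀ ⟨0, by omega⟩ ≤ lamF hL σ X θ₀ / 2 := by
  have h₀ := hb ⟨0, by omega⟩
  rw [radius_eq hL hγ hF hT hb, mul_div_cancel_left₀ _ h₀.ne', ← mul_div_assoc,
    div_le_iff₀ (by positivity)]
  rw [InitCond₂, show frobNorm X = ‖X‖ from rfl] at hinit
  linarith

/-- The layers of `θ` are within the prescribed radii of those of `θ₀`. -/
def Near (hL : 2 ≤ L) (γ : ℝ) (σ : ℝ → ℝ) (X : Matrix (Fin N) (Fin (n 0)) ℝ)
    (Y : Matrix (Fin N) (Fin (n L)) ℝ) (θ₀ θ : Params L n) : Prop :=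
  ∀ i, ‖weight θ i - weight θ₀ i‖ ≤ radius hL γ σ X Y θ₀ i

/-- In the first two layers `‖W⁰‖ + 1 = (3/2) λ̄` by the definition of `lamBar`; in the others `‖W⁰‖
+ λ / 2 ≤ (3/2) ‖W⁰‖`. -/
theorem Near.opNorm_weight_le {hL : 2 ≤ L} (hθ : Near hL γ σ X Y θ₀ θ) (hγ : 0 < γ)
    (hn : IsPyramidal N L n) (hF : 0 < lamF hL σ X θ₀)
    (hlam : ∀ i : Fin L, 2 ≤ (i : ℕ) → 0 < lam θ₀ i) (hinit : InitCond₁ hL γ σ X Y θ₀)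
    (i : Fin L) : opNorm (weight θ i) ≤ weightBound θ₀ i := by
  have hb := lamBar_pos hn hlam
  have h := opNorm_add_le (weight θ i - weight θ₀ i) (weight θ₀ i)
  rw [sub_add_cancel] at h
  have h' := (opNorm_le_norm (weight θ i - weight θ₀ i)).trans (hθ i)
  rw [weightBound_val, lamBar]
  split_ifs with hi
  · have := radius_le_one hL hγ hF (lamTop_pos hlam) hb hinit i hi
    linarith
  · have h₁ := radius_le_lam hL hγ hF hlam hb hinit i (by omega)
    have h₂ := lam_le_opNorm hn (θ₀ := θ₀) (i := i) (by omega) (hlam i (by omega))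
    linarith

theorem Near.expandsBy_weight {hL : 2 ≤ L} (hθ : Near hL γ σ X Y θ₀ θ) (hγ : 0 < γ)
    (hn : IsPyramidal N L n) (hF : 0 < lamF hL σ X θ₀)
    (hlam : ∀ i : Fin L, 2 ≤ (i : ℕ) → 0 < lam θ₀ i) (hinit : InitCond₁ hL γ σ X Y θ₀)
    (i : Fin L) (hi : 2 ≤ (i : ℕ)) : ExpandsBy (weight θ i) (lam θ₀ i / 2) := by
  refine ((expandsBy_svMin (hn.2 i hi i.2) (weight θ₀ i)).perturb (B := weight θ i)).mono ?_
  have h₁ := radius_le_lam hL hγ hF hlam (lamBar_pos hn hlam) hinit i hi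
  have h₂ := hθ i
  change _ ≤ lam θ₀ i - _
  linarith

/-- Since `σ` is 1-Lipschitz, `F₁` moves by at most `‖X‖₂` times the radius of the first layer,
which the second initial condition bounds by half of `λ_F`. -/
theorem Near.expandsBy_layer_one {hL : 2 ≤ L} (hθ : Near hL γ σ X Y θ₀ θ) (hγ : 0 < γ)
    (hσ : IsActivation γ β σ) (hn : IsPyramidal N L n) (hF : 0 < lamF hL σ X θ₀)
    (hlam : ∀ i : Fin L, 2 ≤ (i : ℕ) → 0 < lam θ₀ i) (hinit : InitCond₂ hL γ σ X Y θ₀) :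
    ExpandsBy (layer σ X θ 1 (by omega)).transpose (lamF hL σ X θ₀ / 2) := by
  have h₀ : 0 < L := by omega
  have h₁ : ∀ θ : Params L n,
      layer σ X θ 1 (by omega) = (X * weight θ ⟨0, h₀⟩).map σ := fun θ => by
    rw [layer, if_neg (by omega)]; rfl
  rw [h₁]
  refine ((expandsBy_transpose_svMin hn.1 _ hF).perturb
    (B := ((X * weight θ ⟨0, h₀⟩).map σ).transpose)).mono ?_
  have h₂ := opNorm_mul_radius_le hL hγ hF (lamTop_pos hlam) (lamBar_pos hn hlam) hinit
  have h₃ : ‖(X * weight θ ⟨0, h₀⟩).map σ - (X * weight θ₀ ⟨0, h₀⟩).map σ‖ ≤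
      opNorm X * radius hL γ σ X Y θ₀ ⟨0, h₀⟩ := by
    refine (norm_le_of_abs_le (B := X * (weight θ ⟨0, h₀⟩ - weight θ₀ ⟨0, h₀⟩))
      fun i j => ?_).trans ((norm_mul_le_opNorm_mul_norm _ _).trans
        (mul_le_mul_of_nonneg_left (hθ ⟨0, h₀⟩) (opNorm_nonneg _)))
    rw [Matrix.mul_sub]
    exact hσ.abs_sub_le hγ.le _ _
  rw [← Matrix.transpose_sub, Matrix.frobenius_norm_transpose]
  change _ ≤ lamF hL σ X θ₀ - _
  linarith

end Initialization

/-! ### Gradient descent -/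

section Descent

open scoped Matrix.Norms.Frobenius Gradient

variable {N L : ℕ} {n : ℕ → ℕ} {γ β : ℝ} {σ : ℝ → ℝ} {X : Matrix (Fin N) (Fin (n 0)) ℝ}
  {Y : Matrix (Fin N) (Fin (n L)) ℝ} {θ₀ θ v : Params L n}

theorem sum_norm_sq_le (v : Params L n) : (∑ i, ‖v i‖) ^ 2 ≤ L * ‖v‖ ^ 2 := by
  rw [PiLp.norm_sq_eq_of_L2]
  simpa using sq_sum_le_card_mul_sum_sq (s := Finset.univ) (f := fun i => ‖v i‖)

theorem norm_le_sum_norm (v : Params L n) : ‖v‖ ≤ ∑ i, ‖v i‖ := by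
  refine le_of_sq_le_sq ?_ (Finset.sum_nonneg fun i _ => norm_nonneg _)
  rw [PiLp.norm_sq_eq_of_L2]
  exact Finset.sum_sq_le_sq_sum_of_nonneg fun i _ => norm_nonneg _

theorem iInf_lamBar_sq_pos (hL : 0 < L) (hb : ∀ i, 0 < lamBar θ₀ i) :
    0 < ⨅ i : Fin L, lamBar θ₀ i ^ 2 := by
  have : Nonempty (Fin L) := ⟨⟨0, hL⟩⟩
  obtain ⟨j, hj⟩ := exists_eq_ciInf_of_finite (f := fun i : Fin L => lamBar θ₀ i ^ 2)
  rw [← hj]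
  exact pow_pos (hb j) 2

theorem sum_div_weightBound_sq_le (hL : 0 < L) (hb : ∀ i, 0 < lamBar θ₀ i) (v : Params L n) :
    (∑ p ∈ Finset.range L, natExt (fun i => ‖v i‖) 0 p / weightBound θ₀ p) ^ 2 ≤
      L * ‖v‖ ^ 2 / ((3 / 2) ^ 2 * ⨅ i : Fin L, lamBar θ₀ i ^ 2) := by
  have hm := iInf_lamBar_sq_pos hL hb
  rw [Finset.sum_range]
  simp only [natExt_val, weightBound_val]
  refine sq_sum_le_card_mul_sum_sq.trans ?_
  rw [Finset.card_univ, Fintype.card_fin, PiLp.norm_sq_eq_of_L2, mul_div_assoc, Finset.sum_div]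
  gcongr with i
  rw [div_pow, mul_pow]
  gcongr
  exact ciInf_le (f := fun i : Fin L => lamBar θ₀ i ^ 2) (Set.finite_range _).bddBelow i

/-- The two summands of `Q₀` are the two parts of the remainder in `abs_loss_remainder_le`: the
squared first-order change, measured with `weightBound`, and the second-order change paired with the
residual, measured with `max 1 (3/2 * lamBar)`. Cauchy–Schwarz over the layers gives a factor `L`.
-/
theorem loss_add_le (hγ₀ : 0 < γ) (hγ : γ ≤ 1) (hβ : 0 ≤ β) (hσ : IsActivation γ β σ)
    (hL : 2 ≤ L) (hb : ∀ i, 0 < lamBar θ₀ i)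
    (hθ : ∀ i : Fin L, opNorm (weight θ i) ≤ weightBound θ₀ i)
    (hθ' : ∀ i : Fin L, opNorm (weight (θ + v) i) ≤ weightBound θ₀ i)
    (hloss : loss σ X Y θ ≤ loss σ X Y θ₀) :
    loss σ X Y (θ + v) ≤ loss σ X Y θ + inner ℝ (∇ (loss σ X Y) θ) v +
      Q₀ β σ X Y θ₀ / 2 * ‖v‖ ^ 2 := by
  have hw := weightBound_pos hb
  set M : ℕ → ℝ := natExt (fun i => max 1 (3 / 2 * lamBar θ₀ i)) 1 with hM
  have hwM : ∀ i : Fin L, weightBound θ₀ i ≤ M i := fun i => by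
    rw [hM, natExt_val, weightBound_val]
    exact le_max_right _ _
  have h := (le_abs_self _).trans (abs_loss_remainder_le (X := X) (Y := Y) hγ₀.le hγ hβ hσ hw hθ hθ'
    (M := M) (natExt_prop (Q := fun x => 1 ≤ x) (fun i => le_max_left _ _) le_rfl)
    (fun i => (hθ i).trans (hwM i)) (fun i => (hθ' i).trans (hwM i))
    (d := natExt (fun i => ‖v i‖) 0)
    (natExt_prop (Q := fun x => 0 ≤ x) (fun i => norm_nonneg _) le_rfl)
    (fun i => by rw [natExt_val, norm_weight]))
  rw [← inner_gradient_loss hγ₀.le hγ hβ hσ, prod_range_natExt, sum_range_natExt,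
    mul_pow _ (∑ p ∈ Finset.range L, _), prod_weightBound] at h
  change _ ≤ ‖X‖ * R θ₀ * (1 + L * β * (‖X‖ * R θ₀)) / 2 * _ * _ + _ at h
  have hR : 0 ≤ R θ₀ := Finset.prod_nonneg fun i _ => zero_le_one.trans (le_max_left _ _)
  -- The factor `L` already suffices; `Q₀` has `L * √L`, so `√L` is slack.
  have hLsqrt : (L : ℝ) ≤ L * √L := le_mul_of_one_le_right (Nat.cast_nonneg _)
    (Real.one_le_sqrt.mpr (by exact_mod_cast (by omega : 1 ≤ L)))
  have hm := iInf_lamBar_sq_pos (by omega) hb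
  have h₁ : ‖X‖ * R θ₀ * (1 + L * β * (‖X‖ * R θ₀)) / 2 * (∑ i, ‖v i‖) ^ 2 *
      √(2 * loss σ X Y θ) ≤
      ‖X‖ * R θ₀ * (1 + L * β * (‖X‖ * R θ₀)) / 2 * (L * √L * ‖v‖ ^ 2) *
        √(2 * loss σ X Y θ₀) := by
    gcongr
    exact (sum_norm_sq_le v).trans (by gcongr)
  have h₂ : (‖X‖ * ((3 / 2) ^ L * lamBarProd θ₀)) ^ 2 *
      (∑ p ∈ Finset.range L, natExt (fun i => ‖v i‖) 0 p / weightBound θ₀ p) ^ 2 / 2 ≤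
      (‖X‖ * ((3 / 2) ^ L * lamBarProd θ₀)) ^ 2 *
        (L * √L * ‖v‖ ^ 2 / ((3 / 2) ^ 2 * ⨅ i : Fin L, lamBar θ₀ i ^ 2)) / 2 := by
    gcongr
    exact (sum_div_weightBound_sq_le (by omega) hb v).trans (by gcongr)
  have h₃ : Q₀ β σ X Y θ₀ / 2 * ‖v‖ ^ 2 =
      ‖X‖ * R θ₀ * (1 + L * β * (‖X‖ * R θ₀)) / 2 * (L * √L * ‖v‖ ^ 2) *
        √(2 * loss σ X Y θ₀) +
      (‖X‖ * ((3 / 2) ^ L * lamBarProd θ₀)) ^ 2 *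
        (L * √L * ‖v‖ ^ 2 / ((3 / 2) ^ 2 * ⨅ i : Fin L, lamBar θ₀ i ^ 2)) / 2 := by
    obtain ⟨K, rfl⟩ : ∃ K, L = K + 1 := ⟨L - 1, by omega⟩
    rw [Q₀, show frobNorm X = ‖X‖ from rfl, Nat.add_sub_cancel]
    generalize (⨅ i : Fin (K + 1), lamBar θ₀ i ^ 2) = m at hm ⊢
    generalize √(2 * loss σ X Y θ₀) = q
    field_simp
    ring
  linarith

theorem Near.le_norm_gradient_sq {hL : 2 ≤ L} (hθ : Near hL γ σ X Y θ₀ θ) (hγ : 0 < γ)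
    (hγ₁ : γ ≤ 1) (hβ : 0 ≤ β) (hσ : IsActivation γ β σ) (hn : IsPyramidal N L n)
    (hF : 0 < lamF hL σ X θ₀) (hlam : ∀ i : Fin L, 2 ≤ (i : ℕ) → 0 < lam θ₀ i)
    (hinit₁ : InitCond₁ hL γ σ X Y θ₀) (hinit₂ : InitCond₂ hL γ σ X Y θ₀) :
    α₀ hL γ σ X θ₀ * (2 * loss σ X Y θ) ≤ ‖∇ (loss σ X Y) θ‖ ^ 2 := by
  have h := le_norm_gradient (X := X) (Y := Y) hγ hγ₁ hβ hσ hL (half_pos hF).le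
    (hθ.expandsBy_layer_one hγ hσ hn hF hlam hinit₂) (s := natExt (fun i => lam θ₀ i / 2) 0)
    (natExt_prop (Q := fun x => 0 ≤ x) (fun i => div_nonneg (svMin_nonneg _) two_pos.le) le_rfl)
    (fun i hi => by
      rw [natExt_val]; exact hθ.expandsBy_weight hγ hn hF hlam hinit₁ i hi)
  have hprod : ∏ p ∈ Finset.Ico 2 L, natExt (fun i => lam θ₀ i / 2) 0 p =
      lamTop θ₀ / 2 ^ (L - 2) := by
    have hcard : ∏ i ∈ Finset.univ.filter (fun i : Fin L => 2 ≤ (i : ℕ)), (2 : ℝ) =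
        2 ^ (L - 2) := by
      rw [← prod_Ico_two_eq (fun _ => (2 : ℝ)), Finset.prod_const, Nat.card_Ico]
    rw [prod_Ico_two_eq]
    simp only [natExt_val]
    rw [Finset.prod_div_distrib, hcard, lamTop]
  have hT := lamTop_pos hlam
  rw [hprod] at h
  have h' := pow_le_pow_left₀ (by positivity) h 2
  refine le_trans (le_of_eq ?_) h'
  rw [mul_pow, Real.sq_sqrt (mul_nonneg two_pos.le (loss_nonneg θ)), α₀]
  congr 1
  obtain ⟨K, rfl⟩ : ∃ K, L = K + 2 := ⟨L - 2, by omega⟩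
  rw [Nat.add_sub_cancel, div_pow _ (4 : ℝ), pow_add (γ ^ 2), pow_add (4 : ℝ),
    show (4 : ℝ) ^ K = (2 ^ K) ^ 2 by rw [← pow_mul, mul_comm K 2, pow_mul]; norm_num,
    ← pow_mul, mul_comm 2 K, pow_mul]
  field_simp
  norm_num

theorem loss_gradient_step_le {hL : 2 ≤ L} {η : ℝ} (hγ : 0 < γ) (hγ₁ : γ ≤ 1) (hβ : 0 ≤ β)
    (hσ : IsActivation γ β σ) (hn : IsPyramidal N L n) (hF : 0 < lamF hL σ X θ₀)
    (hlam : ∀ i : Fin L, 2 ≤ (i : ℕ) → 0 < lam θ₀ i)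
    (hinit₁ : InitCond₁ hL γ σ X Y θ₀) (hinit₂ : InitCond₂ hL γ σ X Y θ₀) (hη₀ : 0 < η)
    (hηQ : η * Q₀ β σ X Y θ₀ ≤ 1) (hθ : Near hL γ σ X Y θ₀ θ)
    (hθ' : Near hL γ σ X Y θ₀ (θ - η • ∇ (loss σ X Y) θ))
    (hloss : loss σ X Y θ ≤ loss σ X Y θ₀) :
    loss σ X Y (θ - η • ∇ (loss σ X Y) θ) ≤ (1 - η * α₀ hL γ σ X θ₀) * loss σ X Y θ := by
  have hPL := hθ.le_norm_gradient_sq hγ hγ₁ hβ hσ hn hF hlam hinit₁ hinit₂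
  have hw := hθ.opNorm_weight_le hγ hn hF hlam hinit₁
  have hw' := hθ'.opNorm_weight_le hγ hn hF hlam hinit₁
  set g := ∇ (loss σ X Y) θ with hg
  rw [sub_eq_add_neg, ← smul_neg] at hw' ⊢
  have h := loss_add_le hγ hγ₁ hβ hσ hL (lamBar_pos hn hlam) hw hw' hloss
  rw [← hg, inner_smul_right, inner_neg_right, real_inner_self_eq_norm_sq, norm_smul, norm_neg,
    Real.norm_eq_abs, mul_pow, sq_abs] at h
  -- As `η Q₀ ≤ 1`, the quadratic term costs at most half of the first-order decrease `η ‖g‖²`; the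
  -- remaining half is at least `η α₀ Φ`.
  have h₁ : η * (η * Q₀ β σ X Y θ₀) * ‖g‖ ^ 2 ≤ η * 1 * ‖g‖ ^ 2 := by gcongr
  have h₂ : η * (α₀ hL γ σ X θ₀ * (2 * loss σ X Y θ)) ≤ η * ‖g‖ ^ 2 := by gcongr
  linarith

theorem gd_invariant {hL : 2 ≤ L} {η u : ℝ} (hγ : 0 < γ) (hγ₁ : γ ≤ 1) (hβ : 0 ≤ β)
    (hσ : IsActivation γ β σ) (hn : IsPyramidal N L n) (hF : 0 < lamF hL σ X θ₀)
    (hlam : ∀ i : Fin L, 2 ≤ (i : ℕ) → 0 < lam θ₀ i)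
    (hinit₁ : InitCond₁ hL γ σ X Y θ₀) (hinit₂ : InitCond₂ hL γ σ X Y θ₀) (hη₀ : 0 < η)
    (hηQ : η * Q₀ β σ X Y θ₀ ≤ 1) (hu₀ : 0 ≤ u) (hu₁ : u < 1)
    (hu : u ^ 2 = 1 - η * α₀ hL γ σ X θ₀) (hηu : η / (1 - u) ≤ 2 / α₀ hL γ σ X θ₀) (k : ℕ) :
    loss σ X Y (gd σ X Y η θ₀ k) ≤ (u ^ 2) ^ k * loss σ X Y θ₀ ∧
      ∀ i, ‖gd σ X Y η θ₀ (k + 1) i - gd σ X Y η θ₀ k i‖ ≤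
        η * (gradBound X θ₀ i * √(2 * loss σ X Y θ₀)) * u ^ k := by
  have hb := lamBar_pos hn hlam
  have hnear : ∀ k, (∀ i, ‖gd σ X Y η θ₀ k i - θ₀ i‖ ≤
      η * (gradBound X θ₀ i * √(2 * loss σ X Y θ₀)) * ∑ s ∈ Finset.range k, u ^ s) →
      Near hL γ σ X Y θ₀ (gd σ X Y η θ₀ k) := fun k hk i => by
    have hg := gradBound_nonneg (X := X) hb i
    rw [← weight_sub, norm_weight]
    refine (hk i).trans ?_
    have hsum : ∑ s ∈ Finset.range k, u ^ s ≤ 1 / (1 - u) := by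
      rw [geom_sum_eq hu₁.ne, ← neg_div_neg_eq, neg_sub, neg_sub]
      have := sub_pos.mpr hu₁
      gcongr
      linarith [pow_nonneg hu₀ k]
    calc _ ≤ η * (gradBound X θ₀ i * √(2 * loss σ X Y θ₀)) * (1 / (1 - u)) := by gcongr
      _ = gradBound X θ₀ i * √(2 * loss σ X Y θ₀) * (η / (1 - u)) := by ring
      _ ≤ _ := by rw [radius]; gcongr
  have hstep : ∀ k, loss σ X Y (gd σ X Y η θ₀ k) ≤ (u ^ 2) ^ k * loss σ X Y θ₀ →
      Near hL γ σ X Y θ₀ (gd σ X Y η θ₀ k) →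
      ∀ i, ‖gd σ X Y η θ₀ (k + 1) i - gd σ X Y η θ₀ k i‖ ≤
        η * (gradBound X θ₀ i * √(2 * loss σ X Y θ₀)) * u ^ k := fun k hk hN i => by
    have hg := gradBound_nonneg (X := X) hb i
    have h₁ := norm_gradient_apply_le (X := X) (Y := Y) hγ.le hγ₁ hβ hσ (weightBound_pos hb)
      (hN.opNorm_weight_le hγ hn hF hlam hinit₁) i
    have h₂ : √(2 * loss σ X Y (gd σ X Y η θ₀ k)) ≤ u ^ k * √(2 * loss σ X Y θ₀) := by
      rw [Real.sqrt_le_left (by positivity), mul_pow,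
        Real.sq_sqrt (mul_nonneg two_pos.le (loss_nonneg θ₀)), ← pow_mul, mul_comm k 2, pow_mul]
      linarith
    rw [gd, PiLp.sub_apply, sub_sub_cancel_left, norm_neg, PiLp.smul_apply, norm_smul,
      Real.norm_eq_abs, abs_of_pos hη₀]
    calc _ ≤ η * (gradBound X θ₀ i * (u ^ k * √(2 * loss σ X Y θ₀))) := by
          gcongr
          exact h₁.trans (mul_le_mul_of_nonneg_left h₂ hg)
      _ = _ := by ring
  have main : ∀ k, loss σ X Y (gd σ X Y η θ₀ k) ≤ (u ^ 2) ^ k * loss σ X Y θ₀ ∧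
      ∀ i, ‖gd σ X Y η θ₀ k i - θ₀ i‖ ≤
        η * (gradBound X θ₀ i * √(2 * loss σ X Y θ₀)) * ∑ s ∈ Finset.range k, u ^ s := by
    intro k
    induction k with
    | zero => simp [gd]
    | succ k ih =>
      have hN := hnear k ih.2
      -- The displacement bound at `k + 1` uses only the loss at `k`. It must come first, since the
      -- loss decrease requires the new iterate to be in `Near`.
      have hd : ∀ i, ‖gd σ X Y η θ₀ (k + 1) i - θ₀ i‖ ≤ η * (gradBound X θ₀ i *
          √(2 * loss σ X Y θ₀)) * ∑ s ∈ Finset.range (k + 1), u ^ s := fun i => by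
        rw [Finset.sum_range_succ_comm, mul_add]
        exact (norm_sub_le_norm_sub_add_norm_sub _ _ _).trans
          (add_le_add (hstep k ih.1 hN i) (ih.2 i))
      refine ⟨?_, hd⟩
      have hle : loss σ X Y (gd σ X Y η θ₀ k) ≤ loss σ X Y θ₀ := ih.1.trans
        (mul_le_of_le_one_left (loss_nonneg θ₀) (pow_le_one₀ (sq_nonneg u)
          (pow_le_one₀ hu₀ hu₁.le)))
      have h := loss_gradient_step_le hγ hγ₁ hβ hσ hn hF hlam hinit₁ hinit₂ hη₀ hηQ hN
        (hnear (k + 1) hd) hle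
      rw [← hu] at h
      rw [pow_succ', mul_assoc]
      exact h.trans (mul_le_mul_of_nonneg_left ih.1 (sq_nonneg u))
  exact ⟨(main k).1, hstep k (main k).1 (hnear k (main k).2)⟩

end Descent

end PyramidalNet

/-! ### Convergence and rates -/

theorem theorem3p1 {N L : ℕ} {n : ℕ → ℕ} (hL : 2 ≤ L)
    (hn : PyramidalNet.IsPyramidal N L n)
    {γ β : ℝ} (hγ : γ ∈ Set.Ioo (0 : ℝ) 1) (hβ : 0 < β)
    {σ : ℝ → ℝ} (hσ : PyramidalNet.IsActivation γ β σ)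
    (X : Matrix (Fin N) (Fin (n 0)) ℝ) (Y : Matrix (Fin N) (Fin (n L)) ℝ)
    (θ₀ : PyramidalNet.Params L n)
    (hF : 0 < PyramidalNet.lamF hL σ X θ₀)
    (hlam : ∀ i : Fin L, 2 ≤ (i : ℕ) → 0 < PyramidalNet.lam θ₀ i)
    (hinit₁ : PyramidalNet.InitCond₁ hL γ σ X Y θ₀)
    (hinit₂ : PyramidalNet.InitCond₂ hL γ σ X Y θ₀)
    {η : ℝ} (hη₀ : 0 < η)
    (hη : η < min (1 / PyramidalNet.α₀ hL γ σ X θ₀) (1 / PyramidalNet.Q₀ β σ X Y θ₀)) :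
    (0 < 1 - η * PyramidalNet.α₀ hL γ σ X θ₀ ∧ 1 - η * PyramidalNet.α₀ hL γ σ X θ₀ < 1) ∧
    (∀ k : ℕ, PyramidalNet.loss σ X Y (PyramidalNet.gd σ X Y η θ₀ k) ≤
      (1 - η * PyramidalNet.α₀ hL γ σ X θ₀) ^ k * PyramidalNet.loss σ X Y θ₀) ∧
    ∃ θ' : PyramidalNet.Params L n,
      (∀ θ, PyramidalNet.loss σ X Y θ' ≤ PyramidalNet.loss σ X Y θ) ∧
      Tendsto (PyramidalNet.gd σ X Y η θ₀) atTop (𝓝 θ') ∧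
      ∀ k : ℕ, ‖PyramidalNet.gd σ X Y η θ₀ k - θ'‖ ≤
        (1 - η * PyramidalNet.α₀ hL γ σ X θ₀) ^ ((k : ℝ) / 2) *
          PyramidalNet.Q₁ hL γ σ X Y θ₀ := by
  have hγ₀ := hγ.1
  have hγ₁ := hγ.2.le
  have hb := PyramidalNet.lamBar_pos hn hlam
  have hα := PyramidalNet.α₀_pos hL hγ₀ hF (PyramidalNet.lamTop_pos hlam)
  obtain ⟨hηα, hηQ⟩ := lt_min_iff.mp hη
  -- Positivity of `Q₀` is read off from `0 < η < 1 / Q₀`.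
  have hQ : 0 < PyramidalNet.Q₀ β σ X Y θ₀ := one_div_pos.mp (hη₀.trans hηQ)
  rw [lt_div_iff₀ hα] at hηα
  rw [lt_div_iff₀ hQ] at hηQ
  have hηα₀ := mul_pos hη₀ hα
  refine ⟨⟨by linarith, by linarith⟩, ?_⟩
  set α := PyramidalNet.α₀ hL γ σ X θ₀ with hαdef
  set u := √(1 - η * α) with hudef
  have hu₀ : 0 ≤ u := Real.sqrt_nonneg _
  have hu : u ^ 2 = 1 - η * α := Real.sq_sqrt (by linarith)
  have hu₁ : u < 1 := by nlinarith
  -- Here `η α = 1 - u² = (1 - u) (1 + u) ≤ 2 (1 - u)`.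
  have hηu : η / (1 - u) ≤ 2 / α := by
    rw [div_le_div_iff₀ (by linarith) hα]
    nlinarith
  have key := PyramidalNet.gd_invariant hγ₀ hγ₁ hβ.le hσ hn hF hlam hinit₁ hinit₂ hη₀ hηQ.le
    hu₀ hu₁ hu hηu
  rw [← hu]
  refine ⟨fun k => (key k).1, ?_⟩
  set C := η * ((∑ i, PyramidalNet.gradBound X θ₀ i) * √(2 * PyramidalNet.loss σ X Y θ₀))
    with hC
  have hC₀ : 0 ≤ (∑ i, PyramidalNet.gradBound X θ₀ i) * √(2 * PyramidalNet.loss σ X Y θ₀) :=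
    mul_nonneg (Finset.sum_nonneg fun i _ => PyramidalNet.gradBound_nonneg hb i)
      (Real.sqrt_nonneg _)
  have hdist : ∀ k, dist (PyramidalNet.gd σ X Y η θ₀ k) (PyramidalNet.gd σ X Y η θ₀ (k + 1)) ≤
      C * u ^ k := fun k => by
    rw [dist_comm, dist_eq_norm]
    refine (PyramidalNet.norm_le_sum_norm _).trans
      ((Finset.sum_le_sum fun i _ => (key k).2 i).trans (le_of_eq ?_))
    rw [hC, ← Finset.sum_mul, ← Finset.mul_sum, ← Finset.sum_mul]
  obtain ⟨θ', hθ'⟩ := cauchySeq_tendsto_of_complete (cauchySeq_of_le_geometric u C hu₁ hdist)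
  have hcont : Continuous (PyramidalNet.loss σ X Y : PyramidalNet.Params L n → ℝ) :=
    continuous_iff_continuousAt.mpr fun θ =>
      (PyramidalNet.hasFDerivAt_loss hγ₀.le hγ₁ hβ.le hσ θ).continuousAt
  have hzero : PyramidalNet.loss σ X Y θ' ≤ 0 := by
    refine le_of_tendsto_of_tendsto' ((hcont.tendsto θ').comp hθ') ?_ fun k => (key k).1
    rw [← zero_mul (PyramidalNet.loss σ X Y θ₀)]
    exact (tendsto_pow_atTop_nhds_zero_of_lt_one (sq_nonneg u)
      (pow_lt_one₀ hu₀ hu₁ two_ne_zero)).mul_const _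
  refine ⟨θ', fun θ => hzero.trans (PyramidalNet.loss_nonneg θ), hθ', fun k => ?_⟩
  have hpow : (u ^ 2) ^ ((k : ℝ) / 2) = u ^ k := by
    rw [← Real.rpow_natCast u 2, ← Real.rpow_mul hu₀, ← Real.rpow_natCast u k]
    congr 1
    push_cast
    ring
  rw [hpow, PyramidalNet.Q₁_eq hL hb, ← dist_eq_norm]
  refine (dist_le_of_le_geometric_of_tendsto u C hu₁ hdist hθ' k).trans ?_
  calc C * u ^ k / (1 - u) = u ^ k * ((∑ i, PyramidalNet.gradBound X θ₀ i) *
        √(2 * PyramidalNet.loss σ X Y θ₀) * (η / (1 - u))) := by rw [hC]; ring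
    _ ≤ _ := by gcongr
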